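/- Let $q\in(-1,0)\cup(0,1)$. Let $\mathcal{P}_{\leq 1}(\mathbb{R})$ be the set of compactly supported probability measures on $\mathbb{R}$ that are absolutely continuous with respect to Lebesgue measure with a density bounded by $1$. Let $MK_{(q)}$ be the $q$-deformed Markov–Krein map: it sends a compactly supported probability measure $\mu$ on $\mathbb{R}$ with density bounded by $1/|q|$ to the unique compactly supported probability measure $\nu$ on $\mathbb{R}$ such that, for all complex $z$ near $0$, $$\exp\Big(-q\sum_{k\ge 0}\mu_k z^{k+1}\Big)=1-q\sum_{k\ge 0}\nu_k z^{k+1},$$ where $\mu_k,\nu_k$ denote the $k$-th moments of $\mu,\nu$. For an integer $r\ge 1$ and real numbers $\alpha_1<\beta_1<\alpha_2<\beta_2<\cdots<\alpha_r<\beta_r$ with $\sum_{i=1}^r(\beta_i-\alpha_i)=1$, let $$f^{(q)}_{\alpha,\beta}(x)=\frac{\sin(\pi q)}{\pi q}\prod_{i=1}^r|x-\alpha_i|^{-q}|x-\beta_i|^{q}\quad\text{for } x\in\bigcup_{i=1}^r[\alpha_i,\beta_i],\qquad f^{(q)}_{\alpha,\beta}(x)=0\text{ otherwise.}$$ Then every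 $f^{(q)}_{\alpha,\beta}$ is a probability density, and the set $\mathcal{P}^{(q)}_{\alpha,\beta}(\mathbb{R})$ of all probability measures $f^{(q)}_{\alpha,\beta}(x)\,dx$ (over all such $r,\alpha,\beta$) is a dense subset of $MK_{(q)}(\mathcal{P}_{\leq 1}(\mathbb{R}))$: it is contained in $MK_{(q)}(\mathcal{P}_{\leq 1}(\mathbb{R}))$, and every element of $MK_{(q)}(\mathcal{P}_{\leq 1}(\mathbb{R}))$ lies in its closure for the topology of weak convergence of probability measures and is moreover the limit of a sequence from $\mathcal{P}^{(q)}_{\alpha,\beta}(\mathbb{R})$ that converges both weakly and in the sense of moments (all moments converge). -/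

import Mathlib

open MeasureTheory Filter Topology

noncomputable section

/-- The compactly supported probability measures on the real line that have a probability density
with respect to Lebesgue measure bounded by `c`. -/
def BoundedDensity (c : ℝ) : Set (ProbabilityMeasure ℝ) :=
  {μ | IsCompact (μ : Measure ℝ).support ∧
    ∃ f : ℝ → ℝ, Measurable f ∧ (∀ x, 0 ≤ f x ∧ f x ≤ c) ∧
      (μ : Measure ℝ) = volume.withDensity (fun x => ENNReal.ofReal (f x))}

/-- The generating function `∑ₖ μₖ z ^ (k + 1)` of the moments `μₖ` of `μ`. -/
def momentSeries (μ : ProbabilityMeasure ℝ) (z : ℂ) : ℂ :=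
  ∑' k : ℕ, ((∫ t : ℝ, t ^ k ∂(μ : Measure ℝ) : ℝ) : ℂ) * z ^ (k + 1)

/-- The graph of the `q`-deformed Markov-Krein map, which sends a compactly supported probability
measure `μ` with density at most `1 / |q|` to the compactly supported probability measure `ν` with
`exp (- q ∑ₖ μₖ z ^ (k + 1)) = 1 - q ∑ₖ νₖ z ^ (k + 1)`. Both series converge for `z` close to
zero, since the supports are compact, and the moments determine `ν`. -/
def IsMarkovKrein (q : ℝ) (μ ν : ProbabilityMeasure ℝ) : Prop :=
  μ ∈ BoundedDensity (1 / |q|) ∧ IsCompact (ν : Measure ℝ).support ∧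
    ∀ᶠ z in 𝓝 (0 : ℂ),
      Complex.exp (-(q : ℂ) * momentSeries μ z) = 1 - (q : ℂ) * momentSeries ν z

/-- The image of a set of measures under the `q`-deformed Markov-Krein map. -/
def markovKreinImage (q : ℝ) (S : Set (ProbabilityMeasure ℝ)) : Set (ProbabilityMeasure ℝ) :=
  {ν | ∃ μ ∈ S, IsMarkovKrein q μ ν}

/-- `α₁ < β₁ < α₂ < β₂ < ⋯ < αᵣ < βᵣ`, and the intervals `[αᵢ, βᵢ]` have total length one. -/
def IsIntervalSystem {r : ℕ} (α β : Fin r → ℝ) : Prop :=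
  (∀ i, α i < β i) ∧ (∀ i j, i < j → β i < α j) ∧ ∑ i, (β i - α i) = 1

/-- The function that equals `sin (π q) / (π q) * ∏ᵢ |x - αᵢ| ^ (-q) * |x - βᵢ| ^ q` on the union
of the intervals `[αᵢ, βᵢ]`, and zero elsewhere. -/
def intervalDensity (q : ℝ) {r : ℕ} (α β : Fin r → ℝ) : ℝ → ℝ :=
  (⋃ i, Set.Icc (α i) (β i)).indicator fun x =>
    Real.sin (Real.pi * q) / (Real.pi * q) * ∏ i, (|x - α i| ^ (-q) * |x - β i| ^ q)

/-- The measure with density `intervalDensity q α β`. -/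
def intervalMeasure (q : ℝ) {r : ℕ} (α β : Fin r → ℝ) : Measure ℝ :=
  volume.withDensity fun x => ENNReal.ofReal (intervalDensity q α β x)

/-- The probability measures with a density `intervalDensity q α β`. -/
def intervalFamily (q : ℝ) : Set (ProbabilityMeasure ℝ) :=
  {ν | ∃ (r : ℕ) (α β : Fin r → ℝ), IsIntervalSystem α β ∧
    (ν : Measure ℝ) = intervalMeasure q α β}

end

/-!
On each interval `(αᵢ, βᵢ)` the rational function `R x = ∏ᵢ (x - βᵢ) / (x - αᵢ)` increases from
`-∞` to `0`, and the density of `intervalMeasure q α β` is `sin (π q) / (π q) * |R x| ^ q`. Let `w`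
lie to the right of all intervals. If `x₁, …, xᵣ` are the solutions of `R x = -s`, the partial
fraction expansion of `1 / (R + s)` gives, as in Boole's identity,
`∑ᵢ 1 / (R' xᵢ * (w - xᵢ)) = 1 / (R w + s) - 1 / (1 + s)`. Substituting `s = -R x` on every interval
therefore turns the Stieltjes transform of `|R x| ^ q dx` at `w` into the beta integral
`∫ s ^ q (1 / (R w + s) - 1 / (1 + s)) ds`, and that of `intervalMeasure q α β` is
`(1 - R w ^ q) / q`. Lebesgue measure on the union of the intervals has the Stieltjes transform
`-log (R w)`, so the Markov-Krein map sends it to `intervalMeasure q α β`.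

A density with values in `[0, 1]` is approximated by indicator functions of unions of many short
intervals. The moments of the image under the Markov-Krein map are polynomials in the moments of the
original measure, hence the moments of the images converge too, and for measures with uniformly
bounded supports this implies weak convergence.
-/

section NodalRatio

variable {ι 𝕜 : Type*} [Fintype ι]

/-- The rational function `∏ᵢ (x - βᵢ) / (x - αᵢ)`. -/
def nodalRatio [Field 𝕜] (α β : ι → 𝕜) (x : 𝕜) : 𝕜 :=
  ∏ i, (x - β i) / (x - α i)

/-- The negated residue of `nodalRatio α β` at the simple pole `α i`. -/
def nodalRatioWeight [DecidableEq ι] [Field 𝕜] (α β : ι → 𝕜) (i : ι) : 𝕜 :=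
  -(Lagrange.nodalWeight Finset.univ α i * ∏ j, (α i - β j))

theorem prod_self_sub_eq_zero [CommRing 𝕜] (α : ι → 𝕜) (i : ι) : ∏ j, (α i - α j) = 0 :=
  Finset.prod_eq_zero (Finset.mem_univ i) (sub_self _)

theorem nodalRatio_inv [Field 𝕜] (α β : ι → 𝕜) (x : 𝕜) :
    (nodalRatio α β x)⁻¹ = nodalRatio β α x := by
  simp only [nodalRatio, ← Finset.prod_inv_distrib, inv_div]

theorem degree_nodal_sub_nodal_lt [Field 𝕜] (α β : ι → 𝕜) :
    (Lagrange.nodal Finset.univ α - Lagrange.nodal Finset.univ β).degree <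
      (Finset.univ : Finset ι).card := by
  have h := Polynomial.degree_sub_lt_left (p := Lagrange.nodal Finset.univ α)
    (q := Lagrange.nodal Finset.univ β) (by simp only [Lagrange.degree_nodal])
    Lagrange.nodal_ne_zero
    (by rw [Lagrange.nodal_monic.leadingCoeff, Lagrange.nodal_monic.leadingCoeff])
  rwa [Lagrange.degree_nodal] at h

theorem nodalRatio_eq_one_sub_sum [DecidableEq ι] [Field 𝕜] {α : ι → 𝕜}
    (hα : Function.Injective α) (β : ι → 𝕜) {x : 𝕜} (hx : ∀ i, x ≠ α i) :
    nodalRatio α β x = 1 - ∑ i, nodalRatioWeight α β i / (x - α i) := by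
  have hinterp := congrArg (Polynomial.eval x) (Lagrange.eq_interpolate hα.injOn
    (degree_nodal_sub_nodal_lt α β))
  rw [Lagrange.eval_interpolate_not_at_node _ fun i _ => hx i] at hinterp
  have hx0 : ∏ i, (x - α i) ≠ 0 := Finset.prod_ne_zero_iff.2 fun i _ => sub_ne_zero.2 (hx i)
  have hterm : ∀ i, Lagrange.nodalWeight Finset.univ α i * (x - α i)⁻¹ *
      (0 - ∏ j, (α i - β j)) = nodalRatioWeight α β i / (x - α i) := fun i => by
    rw [nodalRatioWeight]
    ring
  simp only [Polynomial.eval_sub, Lagrange.eval_nodal, prod_self_sub_eq_zero, hterm] at hinterp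
  rw [nodalRatio, Finset.prod_div_distrib, div_eq_iff hx0]
  linear_combination -hinterp

theorem hasDerivAt_nodalRatio [DecidableEq ι] [NontriviallyNormedField 𝕜] {α : ι → 𝕜}
    (hα : Function.Injective α) (β : ι → 𝕜) {x : 𝕜} (hx : ∀ i, x ≠ α i) :
    HasDerivAt (nodalRatio α β) (∑ i, nodalRatioWeight α β i / (x - α i) ^ 2) x := by
  have hnear : ∀ᶠ y in 𝓝 x, ∀ i, y ≠ α i :=
    eventually_all.2 fun i => isOpen_ne.mem_nhds (hx i)
  have hterm : ∀ i ∈ Finset.univ, HasDerivAt (fun y => nodalRatioWeight α β i / (y - α i))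
      (-(nodalRatioWeight α β i / (x - α i) ^ 2)) x := fun i _ => by
    have hinv := ((hasDerivAt_id' x).sub_const (α i)).fun_inv (sub_ne_zero.2 (hx i))
    simp only [div_eq_mul_inv (nodalRatioWeight α β i)]
    exact (hinv.const_mul _).congr_deriv (by ring)
  have hsum := (HasDerivAt.fun_sum hterm).const_sub 1
  rw [Finset.sum_neg_distrib, neg_neg] at hsum
  exact hsum.congr_of_eventuallyEq
    (hnear.mono fun y hy => nodalRatio_eq_one_sub_sum hα β hy)

theorem hasDerivAt_nodalRatio_at_zero [DecidableEq ι] [NontriviallyNormedField 𝕜] {α β : ι → 𝕜}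
    {i : ι} (hβ : ∀ j, β i ≠ α j) :
    HasDerivAt (nodalRatio α β) (-(nodalRatioWeight β α i)⁻¹) (β i) := by
  set g : 𝕜 → 𝕜 := fun t => (∏ j ∈ Finset.univ.erase i, (t - β j)) / ∏ j, (t - α j) with hg
  have hne : ∏ j, (β i - α j) ≠ 0 := Finset.prod_ne_zero_iff.2 fun j _ => sub_ne_zero.2 (hβ j)
  have hgd : DifferentiableAt 𝕜 g (β i) := by fun_prop (disch := exact hne)
  have hfactor : nodalRatio α β = fun t => (t - β i) * g t := by
    ext t
    rw [nodalRatio, Finset.prod_div_distrib, ← Finset.mul_prod_erase _ _ (Finset.mem_univ i),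
      mul_div_assoc]
  have hderiv := ((hasDerivAt_id (β i)).sub_const (β i)).mul hgd.hasDerivAt
  have hval : g (β i) = -(nodalRatioWeight β α i)⁻¹ := by
    rw [nodalRatioWeight, Lagrange.nodalWeight, inv_neg, neg_neg, mul_inv,
      ← Finset.prod_inv_distrib]
    simp only [inv_inv, hg, div_eq_mul_inv]
  rw [hfactor, ← hval]
  exact hderiv.congr_deriv (by simp)

theorem nodalRatio_sub_eq_mul_of_level [Field 𝕜] {α β x : ι → 𝕜} {y : 𝕜}
    (hx : Function.Injective x) (hxα : ∀ i j, x i ≠ α j) (hxy : ∀ i, nodalRatio α β (x i) = y)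
    {t : 𝕜} (ht : ∀ i, t ≠ α i) :
    nodalRatio α β t - y = (1 - y) * nodalRatio α x t := by
  have hpoly : Lagrange.nodal Finset.univ β - Lagrange.nodal Finset.univ x -
      y • (Lagrange.nodal Finset.univ α - Lagrange.nodal Finset.univ x) = 0 := by
    refine Polynomial.eq_zero_of_degree_lt_of_eval_index_eq_zero (s := Finset.univ) hx.injOn
      ?_ fun i _ => ?_
    · refine (Polynomial.degree_sub_le _ _).trans_lt (max_lt (degree_nodal_sub_nodal_lt _ _)
        ((Polynomial.degree_smul_le _ _).trans_lt (degree_nodal_sub_nodal_lt _ _)))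
    · have hne : ∏ j, (x i - α j) ≠ 0 :=
        Finset.prod_ne_zero_iff.2 fun j _ => sub_ne_zero.2 (hxα i j)
      have hlevel := hxy i
      rw [nodalRatio, Finset.prod_div_distrib, div_eq_iff hne] at hlevel
      simp only [Polynomial.eval_sub, Polynomial.eval_smul, smul_eq_mul,
        Lagrange.eval_nodal, prod_self_sub_eq_zero, hlevel, sub_zero, sub_self]
  have hne : ∏ i, (t - α i) ≠ 0 := Finset.prod_ne_zero_iff.2 fun i _ => sub_ne_zero.2 (ht i)
  have heval := congrArg (Polynomial.eval t) hpoly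
  simp only [Polynomial.eval_sub, Polynomial.eval_smul, smul_eq_mul, Lagrange.eval_nodal,
    Polynomial.eval_zero] at heval
  simp only [nodalRatio, Finset.prod_div_distrib]
  field_simp
  linear_combination heval

theorem sum_inv_deriv_mul_of_level [NontriviallyNormedField 𝕜]
    {α β x : ι → 𝕜} {y : 𝕜} (hx : Function.Injective x) (hxα : ∀ i j, x i ≠ α j)
    (hxy : ∀ i, nodalRatio α β (x i) = y) {w : 𝕜} (hwα : ∀ i, w ≠ α i) (hwx : ∀ i, w ≠ x i) :
    ∑ i, (deriv (nodalRatio α β) (x i) * (w - x i))⁻¹ =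
      (nodalRatio α β w - y)⁻¹ - (1 - y)⁻¹ := by
  classical
  have hderiv : ∀ i, (deriv (nodalRatio α β) (x i))⁻¹ =
      -(1 - y)⁻¹ * nodalRatioWeight x α i := fun i => by
    have hnear : ∀ᶠ t in 𝓝 (x i), ∀ j, t ≠ α j :=
      eventually_all.2 fun j => isOpen_ne.mem_nhds (hxα i j)
    have hloc : nodalRatio α β =ᶠ[𝓝 (x i)] fun t => (1 - y) * nodalRatio α x t + y :=
      hnear.mono fun t ht => sub_eq_iff_eq_add.1 (nodalRatio_sub_eq_mul_of_level hx hxα hxy ht)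
    rw [hloc.deriv_eq,
      (((hasDerivAt_nodalRatio_at_zero (hxα i)).const_mul (1 - y)).add_const y).deriv, mul_inv,
      inv_neg, inv_inv]
    ring
  calc ∑ i, (deriv (nodalRatio α β) (x i) * (w - x i))⁻¹
      = -(1 - y)⁻¹ * ∑ i, nodalRatioWeight x α i / (w - x i) := by
        rw [Finset.mul_sum]
        refine Finset.sum_congr rfl fun i _ => ?_
        rw [mul_inv, hderiv, div_eq_mul_inv, mul_assoc]
    _ = (1 - y)⁻¹ * (nodalRatio α x w)⁻¹ - (1 - y)⁻¹ := by
        rw [nodalRatio_inv, nodalRatio_eq_one_sub_sum hx α hwx]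
        ring
    _ = (nodalRatio α β w - y)⁻¹ - (1 - y)⁻¹ := by
        rw [← mul_inv, nodalRatio_sub_eq_mul_of_level hx hxα hxy hwα]

end NodalRatio

namespace IsIntervalSystem

variable {r : ℕ} {α β : Fin r → ℝ}

theorem separated (h : IsIntervalSystem α β) {i j : Fin r} (hij : j ≠ i) :
    β j < α i ∨ β i < α j :=
  (lt_or_gt_of_ne hij).imp (h.2.1 j i) (h.2.1 i j)

theorem injective_left (h : IsIntervalSystem α β) : Function.Injective α := by
  intro i j hij
  by_contra hne
  rcases h.separated hne with hlt | hlt <;> linarith [h.1 i, h.1 j]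

theorem pairwise_disjoint (h : IsIntervalSystem α β) :
    Pairwise (Function.onFun Disjoint fun i => Set.Icc (α i) (β i)) := fun i j hij =>
  Set.disjoint_left.2 fun x hxi hxj => by
    rcases h.separated hij with hlt | hlt <;> linarith [hxi.1, hxi.2, hxj.1, hxj.2]

theorem mul_sub_pos (h : IsIntervalSystem α β) {i j : Fin r} (hij : j ≠ i) {x y : ℝ}
    (hx : x ∈ Set.Icc (α i) (β i)) (hy : y ∈ Set.Icc (α i) (β i)) :
    0 < (x - β j) * (y - α j) := by
  rcases h.separated hij with hlt | hlt
  · exact mul_pos (by linarith [hx.1]) (by linarith [hy.1, h.1 j])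
  · exact mul_pos_of_neg_of_neg (by linarith [hx.2, h.1 j]) (by linarith [hy.2])

theorem prod_mul_prod_neg (h : IsIntervalSystem α β) {i : Fin r} {x y : ℝ}
    (hx : x ∈ Set.Ico (α i) (β i)) (hy : y ∈ Set.Ioc (α i) (β i)) :
    (∏ j, (x - β j)) * ∏ j, (y - α j) < 0 := by
  rw [← Finset.prod_mul_distrib, ← Finset.mul_prod_erase _ _ (Finset.mem_univ i)]
  exact mul_neg_of_neg_of_pos
    (mul_neg_of_neg_of_pos (sub_neg.2 hx.2) (sub_pos.2 hy.1))
    (Finset.prod_pos fun j hj => h.mul_sub_pos (Finset.ne_of_mem_erase hj)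
      (Set.Ico_subset_Icc_self hx) (Set.Ioc_subset_Icc_self hy))

theorem ne_left_of_mem_Ioo (h : IsIntervalSystem α β) {i : Fin r} {x : ℝ}
    (hx : x ∈ Set.Ioo (α i) (β i)) (j : Fin r) : x ≠ α j := by
  have hprod := h.prod_mul_prod_neg (Set.Ioo_subset_Ico_self hx) (Set.Ioo_subset_Ioc_self hx)
  exact sub_ne_zero.1 (Finset.prod_ne_zero_iff.1 (right_ne_zero_of_mul hprod.ne) j
    (Finset.mem_univ j))

theorem nodalRatioWeight_pos (h : IsIntervalSystem α β) (i : Fin r) :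
    0 < nodalRatioWeight α β i := by
  rw [nodalRatioWeight, Lagrange.nodalWeight, ← Finset.mul_prod_erase _ _ (Finset.mem_univ i),
    mul_left_comm, ← Finset.prod_mul_distrib, ← neg_mul, neg_sub]
  refine mul_pos (sub_pos.2 (h.1 i)) (Finset.prod_pos fun j hj => ?_)
  have hmem := Set.left_mem_Icc.2 (h.1 i).le
  rw [mul_comm, ← div_eq_mul_inv]
  exact div_pos_iff.2 (mul_pos_iff.1 (h.mul_sub_pos (Finset.ne_of_mem_erase hj) hmem hmem))

theorem differentiableAt_nodalRatio (h : IsIntervalSystem α β) {i : Fin r} {x : ℝ}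
    (hx : x ∈ Set.Ioo (α i) (β i)) : DifferentiableAt ℝ (nodalRatio α β) x :=
  (hasDerivAt_nodalRatio h.injective_left β (h.ne_left_of_mem_Ioo hx)).differentiableAt

theorem deriv_nodalRatio_pos (h : IsIntervalSystem α β) {i : Fin r} {x : ℝ}
    (hx : x ∈ Set.Ioo (α i) (β i)) : 0 < deriv (nodalRatio α β) x := by
  rw [(hasDerivAt_nodalRatio h.injective_left β (h.ne_left_of_mem_Ioo hx)).deriv]
  exact Finset.sum_pos (fun j _ => div_pos (h.nodalRatioWeight_pos j)
    (sq_pos_of_ne_zero (sub_ne_zero.2 (h.ne_left_of_mem_Ioo hx j)))) ⟨i, Finset.mem_univ i⟩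

theorem strictMonoOn_nodalRatio (h : IsIntervalSystem α β) (i : Fin r) :
    StrictMonoOn (nodalRatio α β) (Set.Ioo (α i) (β i)) :=
  strictMonoOn_of_deriv_pos (convex_Ioo _ _)
    (fun _ hx => (h.differentiableAt_nodalRatio hx).continuousAt.continuousWithinAt)
    fun _ hx => h.deriv_nodalRatio_pos (interior_subset hx)

theorem nodalRatio_neg (h : IsIntervalSystem α β) {i : Fin r} {x : ℝ}
    (hx : x ∈ Set.Ioo (α i) (β i)) : nodalRatio α β x < 0 := by
  rw [nodalRatio, Finset.prod_div_distrib, div_neg_iff, ← mul_neg_iff]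
  exact h.prod_mul_prod_neg (Set.Ioo_subset_Ico_self hx) (Set.Ioo_subset_Ioc_self hx)

theorem exists_nodalRatio_eq_neg (h : IsIntervalSystem α β) (i : Fin r) {s : ℝ} (hs : 0 < s) :
    ∃ x ∈ Set.Ioo (α i) (β i), nodalRatio α β x = -s := by
  set Q : ℝ → ℝ := fun x => ∏ j, (x - β j) + s * ∏ j, (x - α j) with hQ
  have hlt := h.1 i
  have hQα : Q (α i) = ∏ j, (α i - β j) := by
    simp only [hQ, prod_self_sub_eq_zero, mul_zero, add_zero]
  have hQβ : Q (β i) = s * ∏ j, (β i - α j) := by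
    simp only [hQ, prod_self_sub_eq_zero, zero_add]
  have hsign : Q (α i) * Q (β i) < 0 := by
    rw [hQα, hQβ, mul_left_comm]
    exact mul_neg_of_pos_of_neg hs
      (h.prod_mul_prod_neg (Set.left_mem_Ico.2 hlt) (Set.right_mem_Ioc.2 hlt))
  have hzero : (0 : ℝ) ∈ Set.uIcc (Q (α i)) (Q (β i)) := Set.mem_uIcc.2
    ((mul_neg_iff.1 hsign).symm.imp (fun hc => ⟨hc.1.le, hc.2.le⟩) fun hc => ⟨hc.2.le, hc.1.le⟩)
  have hcont : ContinuousOn Q (Set.uIcc (α i) (β i)) := by fun_prop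
  obtain ⟨x, hx, hQx⟩ := intermediate_value_uIcc hcont hzero
  rw [Set.uIcc_of_le hlt.le] at hx
  have hmem : x ∈ Set.Ioo (α i) (β i) :=
    ⟨hx.1.lt_of_ne fun heq => left_ne_zero_of_mul hsign.ne (heq ▸ hQx),
      hx.2.lt_of_ne fun heq => right_ne_zero_of_mul hsign.ne (heq ▸ hQx)⟩
  have hne : ∏ j, (x - α j) ≠ 0 :=
    Finset.prod_ne_zero_iff.2 fun j _ => sub_ne_zero.2 (h.ne_left_of_mem_Ioo hmem j)
  refine ⟨x, hmem, ?_⟩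
  rw [nodalRatio, Finset.prod_div_distrib, div_eq_iff hne]
  linarith

theorem bijOn_neg_nodalRatio (h : IsIntervalSystem α β) (i : Fin r) :
    Set.BijOn (fun x => -nodalRatio α β x) (Set.Ioo (α i) (β i)) (Set.Ioi 0) :=
  ⟨fun _ hx => neg_pos.2 (h.nodalRatio_neg hx),
    fun _ hx _ hy hxy => (h.strictMonoOn_nodalRatio i).injOn hx hy (neg_injective hxy),
    fun _ hs => (h.exists_nodalRatio_eq_neg i hs).imp fun _ hx => ⟨hx.1, neg_eq_iff_eq_neg.2 hx.2⟩⟩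

theorem nodalRatio_mem_Ioc (h : IsIntervalSystem α β) {w : ℝ} (hw : ∀ i, β i < w) :
    nodalRatio α β w ∈ Set.Ioc 0 1 := by
  have hpos : ∀ i, 0 < (w - β i) / (w - α i) := fun i =>
    div_pos (by linarith [hw i]) (by linarith [h.1 i, hw i])
  exact ⟨Finset.prod_pos fun i _ => hpos i, Finset.prod_le_one (fun i _ => (hpos i).le)
    fun i _ => (div_le_one (by linarith [h.1 i, hw i])).2 (by linarith [h.1 i])⟩

end IsIntervalSystem

/-- The inverse of `-nodalRatio α β` on the interval `(α i, β i)`, which it maps bijectively onto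
the positive half-line when `α` and `β` form an interval system. -/
noncomputable def levelPoint {r : ℕ} (α β : Fin r → ℝ) (i : Fin r) : ℝ → ℝ :=
  Function.invFunOn (fun x => -nodalRatio α β x) (Set.Ioo (α i) (β i))

namespace IsIntervalSystem

variable {r : ℕ} {α β : Fin r → ℝ}

theorem levelPoint_mem (h : IsIntervalSystem α β) (i : Fin r) {s : ℝ} (hs : 0 < s) :
    levelPoint α β i s ∈ Set.Ioo (α i) (β i) :=
  Function.invFunOn_mem ((h.bijOn_neg_nodalRatio i).surjOn hs)

theorem nodalRatio_levelPoint (h : IsIntervalSystem α β) (i : Fin r) {s : ℝ} (hs : 0 < s) :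
    nodalRatio α β (levelPoint α β i s) = -s :=
  neg_eq_iff_eq_neg.1 (Function.invFunOn_eq ((h.bijOn_neg_nodalRatio i).surjOn hs))

theorem levelPoint_neg_nodalRatio (h : IsIntervalSystem α β) {i : Fin r} {x : ℝ}
    (hx : x ∈ Set.Ioo (α i) (β i)) : levelPoint α β i (-nodalRatio α β x) = x :=
  (h.bijOn_neg_nodalRatio i).injOn.leftInvOn_invFunOn hx

theorem antitoneOn_levelPoint (h : IsIntervalSystem α β) (i : Fin r) :
    AntitoneOn (levelPoint α β i) (Set.Ioi 0) := fun s hs t ht hst => by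
  rw [← (h.strictMonoOn_nodalRatio i).le_iff_le (h.levelPoint_mem i ht) (h.levelPoint_mem i hs),
    h.nodalRatio_levelPoint i hs, h.nodalRatio_levelPoint i ht]
  exact neg_le_neg hst

theorem sum_inv_deriv_mul_levelPoint (h : IsIntervalSystem α β) {w : ℝ} (hw : ∀ i, β i < w)
    {s : ℝ} (hs : 0 < s) :
    ∑ i, (deriv (nodalRatio α β) (levelPoint α β i s) * (w - levelPoint α β i s))⁻¹ =
      (nodalRatio α β w + s)⁻¹ - (1 + s)⁻¹ := by
  have hmem := fun i => h.levelPoint_mem i hs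
  have hinj : Function.Injective fun i => levelPoint α β i s := fun i j hij => by
    by_contra hne
    exact Set.disjoint_left.1 (h.pairwise_disjoint hne) (Set.Ioo_subset_Icc_self (hmem i))
      (by simpa only [hij] using Set.Ioo_subset_Icc_self (hmem j))
  rw [sum_inv_deriv_mul_of_level hinj (fun i j => h.ne_left_of_mem_Ioo (hmem i) j)
    (fun i => h.nodalRatio_levelPoint i hs) (fun i => ((h.1 i).trans (hw i)).ne')
    fun i => ((hmem i).2.trans (hw i)).ne', sub_neg_eq_add, sub_neg_eq_add]

theorem lintegral_comp_neg_nodalRatio_div (h : IsIntervalSystem α β) (i : Fin r) (w : ℝ)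
    (φ : ℝ → ENNReal) :
    ∫⁻ x in Set.Ioo (α i) (β i), φ (-nodalRatio α β x) * ENNReal.ofReal (w - x)⁻¹ =
      ∫⁻ s in Set.Ioi (0 : ℝ), φ s * ENNReal.ofReal
        (deriv (nodalRatio α β) (levelPoint α β i s) * (w - levelPoint α β i s))⁻¹ := by
  rw [← (h.bijOn_neg_nodalRatio i).image_eq, lintegral_image_eq_lintegral_abs_deriv_mul
    measurableSet_Ioo
    (fun x hx => (h.differentiableAt_nodalRatio hx).hasDerivAt.fun_neg.hasDerivWithinAt)
    (h.bijOn_neg_nodalRatio i).injOn]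
  refine setLIntegral_congr_fun measurableSet_Ioo fun x hx => ?_
  have hderiv := h.deriv_nodalRatio_pos hx
  simp only [h.levelPoint_neg_nodalRatio hx]
  rw [abs_neg, abs_of_pos hderiv, mul_left_comm, ← ENNReal.ofReal_mul hderiv.le, mul_inv,
    mul_inv_cancel_left₀ hderiv.ne']

theorem aemeasurable_inv_deriv_mul_levelPoint (h : IsIntervalSystem α β) (i : Fin r) (w : ℝ) :
    AEMeasurable (fun s => ENNReal.ofReal
      (deriv (nodalRatio α β) (levelPoint α β i s) * (w - levelPoint α β i s))⁻¹)
      (volume.restrict (Set.Ioi 0)) := by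
  have hpoint : AEMeasurable (levelPoint α β i) (volume.restrict (Set.Ioi 0)) :=
    aemeasurable_restrict_of_antitoneOn measurableSet_Ioi (h.antitoneOn_levelPoint i)
  exact (((measurable_deriv _).comp_aemeasurable hpoint).mul
    (hpoint.const_sub w)).inv.ennreal_ofReal

theorem sum_lintegral_comp_neg_nodalRatio_div (h : IsIntervalSystem α β) {w : ℝ}
    (hw : ∀ i, β i < w) {φ : ℝ → ENNReal} (hφ : Measurable φ) :
    ∑ i, ∫⁻ x in Set.Ioo (α i) (β i), φ (-nodalRatio α β x) * ENNReal.ofReal (w - x)⁻¹ =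
      ∫⁻ s in Set.Ioi (0 : ℝ),
        φ s * ENNReal.ofReal ((nodalRatio α β w + s)⁻¹ - (1 + s)⁻¹) := by
  rw [Finset.sum_congr rfl fun i _ => h.lintegral_comp_neg_nodalRatio_div i w φ,
    ← lintegral_finsetSum' _ fun i _ =>
      hφ.aemeasurable.fun_mul (h.aemeasurable_inv_deriv_mul_levelPoint i w)]
  refine setLIntegral_congr_fun measurableSet_Ioi fun s hs => ?_
  have hmem := fun i => h.levelPoint_mem i hs
  rw [← Finset.mul_sum, ← ENNReal.ofReal_sum_of_nonneg fun i _ => inv_nonneg.2 (mul_nonneg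
    (h.deriv_nodalRatio_pos (hmem i)).le (sub_nonneg.2 ((hmem i).2.trans (hw i)).le)),
    h.sum_inv_deriv_mul_levelPoint hw hs]

end IsIntervalSystem

section GammaIntegrals

theorem lintegral_rpow_mul_exp_neg_mul_Ioi {a r : ℝ} (ha : 0 < a) (hr : 0 < r) :
    ∫⁻ t in Set.Ioi (0 : ℝ), ENNReal.ofReal (t ^ (a - 1) * Real.exp (-(r * t))) =
      ENNReal.ofReal (Real.Gamma a * r ^ (-a)) := by
  have hpos : 0 < Real.Gamma a * r ^ (-a) := mul_pos (Real.Gamma_pos_of_pos ha) (by positivity)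
  have hval := Real.integral_rpow_mul_exp_neg_mul_Ioi ha hr
  rw [one_div, Real.inv_rpow hr.le, ← Real.rpow_neg hr.le, mul_comm] at hval
  rw [← hval, ofReal_integral_eq_lintegral_ofReal (.of_integral_ne_zero (hval ▸ hpos.ne'))]
  exact (ae_restrict_mem measurableSet_Ioi).mono fun t ht =>
    mul_nonneg (Real.rpow_nonneg (Set.mem_Ioi.1 ht).le _) (Real.exp_nonneg _)

theorem lintegral_rpow_mul_rpow_mul_exp_neg_Ioi {a t : ℝ} (b x : ℝ) (ha : 0 < a) (ht : 0 < t) :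
    ∫⁻ s in Set.Ioi (0 : ℝ), ENNReal.ofReal (s ^ (a - 1)) *
        ENNReal.ofReal (t ^ (a + b - 1) * Real.exp (-((x + s) * t))) =
      ENNReal.ofReal (Real.Gamma a) * ENNReal.ofReal (t ^ (b - 1) * Real.exp (-(x * t))) := by
  have hsplit : ∀ s ∈ Set.Ioi (0 : ℝ), ENNReal.ofReal (s ^ (a - 1)) *
        ENNReal.ofReal (t ^ (a + b - 1) * Real.exp (-((x + s) * t))) =
      ENNReal.ofReal (t ^ (a + b - 1) * Real.exp (-(x * t))) *
        ENNReal.ofReal (s ^ (a - 1) * Real.exp (-(t * s))) := fun s (hs : 0 < s) => by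
    have hexp : Real.exp (-((x + s) * t)) = Real.exp (-(x * t)) * Real.exp (-(t * s)) := by
      rw [← Real.exp_add]
      ring_nf
    rw [← ENNReal.ofReal_mul (by positivity), ← ENNReal.ofReal_mul (by positivity), hexp]
    ring_nf
  have hpow : t ^ (b - 1) = t ^ (a + b - 1) * t ^ (-a) := by
    rw [← Real.rpow_add ht]
    ring_nf
  rw [setLIntegral_congr_fun measurableSet_Ioi hsplit, lintegral_const_mul _ (by fun_prop),
    lintegral_rpow_mul_exp_neg_mul_Ioi ha ht, ← ENNReal.ofReal_mul (by positivity),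
    ← ENNReal.ofReal_mul (Real.Gamma_pos_of_pos ha).le, hpow]
  ring_nf

theorem lintegral_rpow_mul_add_rpow_Ioi {a b x : ℝ} (ha : 0 < a) (hb : 0 < b) (hx : 0 < x) :
    ∫⁻ s in Set.Ioi (0 : ℝ), ENNReal.ofReal (s ^ (a - 1) * (x + s) ^ (-(a + b))) =
      ENNReal.ofReal (Real.Gamma a * Real.Gamma b / Real.Gamma (a + b) * x ^ (-b)) := by
  have hΓa := Real.Gamma_pos_of_pos ha
  have hinner : ∀ s ∈ Set.Ioi (0 : ℝ), ENNReal.ofReal (s ^ (a - 1) * (x + s) ^ (-(a + b))) =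
      ENNReal.ofReal (Real.Gamma (a + b))⁻¹ * ∫⁻ t in Set.Ioi (0 : ℝ),
        ENNReal.ofReal (s ^ (a - 1)) *
          ENNReal.ofReal (t ^ (a + b - 1) * Real.exp (-((x + s) * t))) := fun s (hs : 0 < s) => by
    rw [lintegral_const_mul _ (by fun_prop),
      lintegral_rpow_mul_exp_neg_mul_Ioi (add_pos ha hb) (add_pos hx hs),
      ← ENNReal.ofReal_mul (by positivity), ← ENNReal.ofReal_mul (by positivity)]
    congr 1
    field_simp
  rw [setLIntegral_congr_fun measurableSet_Ioi hinner, lintegral_const_mul' _ _ (by finiteness),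
    lintegral_lintegral_swap (by fun_prop), setLIntegral_congr_fun measurableSet_Ioi
      fun t ht => lintegral_rpow_mul_rpow_mul_exp_neg_Ioi b x ha ht,
    lintegral_const_mul _ (by fun_prop), lintegral_rpow_mul_exp_neg_mul_Ioi hb hx,
    ← ENNReal.ofReal_mul hΓa.le, ← ENNReal.ofReal_mul (by positivity)]
  ring_nf

theorem lintegral_add_rpow_Ioc {a b c p : ℝ} (hac : 0 < a + c) (hab : a ≤ b) (hp : p ≠ 0) :
    ∫⁻ x in Set.Ioc a b, ENNReal.ofReal ((x + c) ^ (p - 1)) =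
      ENNReal.ofReal (((b + c) ^ p - (a + c) ^ p) / p) := by
  have hpos : ∀ x ∈ Set.Icc a b, 0 < x + c := fun x hx => by linarith [hx.1]
  have hint : IntervalIntegrable (fun x => (x + c) ^ (p - 1)) volume a b :=
    ContinuousOn.intervalIntegrable_of_Icc hab <| ContinuousOn.rpow_const (by fun_prop)
      fun x hx => .inl (hpos x hx).ne'
  have hval : ∫ x in a..b, (x + c) ^ (p - 1) = ((b + c) ^ p - (a + c) ^ p) / p := by
    rw [intervalIntegral.integral_comp_add_right (fun x => x ^ (p - 1)), integral_rpow,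
      sub_add_cancel]
    refine .inr ⟨fun h => hp (by linarith), fun h => ?_⟩
    rw [Set.uIcc_of_le (by linarith)] at h
    linarith [h.1]
  rw [← hval, intervalIntegral.integral_of_le hab, ofReal_integral_eq_lintegral_ofReal
    ((intervalIntegrable_iff_integrableOn_Ioc_of_le hab).1 hint)]
  exact (ae_restrict_mem measurableSet_Ioc).mono fun x hx =>
    Real.rpow_nonneg (hpos x (Set.Ioc_subset_Icc_self hx)).le _

theorem Gamma_one_add_mul_Gamma_one_sub {q : ℝ} (hq : q ≠ 0) :
    Real.Gamma (1 + q) * Real.Gamma (1 - q) = Real.pi * q / Real.sin (Real.pi * q) := by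
  rw [add_comm, Real.Gamma_add_one hq, mul_assoc, Real.Gamma_mul_Gamma_one_sub]
  ring

theorem pi_mul_div_sin_pos {q : ℝ} (hq0 : q ≠ 0) (hq1 : |q| < 1) :
    0 < Real.pi * q / Real.sin (Real.pi * q) := by
  obtain ⟨hneg, hpos⟩ := abs_lt.1 hq1
  rw [← Gamma_one_add_mul_Gamma_one_sub hq0]
  exact mul_pos (Real.Gamma_pos_of_pos (by linarith)) (Real.Gamma_pos_of_pos (by linarith))

theorem lintegral_rpow_mul_inv_sub_inv_Ioi {q ρ : ℝ} (hq0 : q ≠ 0) (hq1 : |q| < 1)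
    (hρ : ρ ∈ Set.Ioc 0 1) :
    ∫⁻ s in Set.Ioi (0 : ℝ), ENNReal.ofReal (s ^ q) * ENNReal.ofReal ((ρ + s)⁻¹ - (1 + s)⁻¹) =
      ENNReal.ofReal (Real.pi * q / Real.sin (Real.pi * q)) *
        ENNReal.ofReal ((1 - ρ ^ q) / q) := by
  obtain ⟨hneg, hpos⟩ := abs_lt.1 hq1
  have hdiff : ∀ s ∈ Set.Ioi (0 : ℝ), ENNReal.ofReal (s ^ q) *
        ENNReal.ofReal ((ρ + s)⁻¹ - (1 + s)⁻¹) = ∫⁻ x in Set.Ioc ρ 1,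
          ENNReal.ofReal (s ^ q) * ENNReal.ofReal ((x + s) ^ (-1 - 1 : ℝ)) := by
    intro s (hs : 0 < s)
    rw [lintegral_const_mul _ (by fun_prop),
      lintegral_add_rpow_Ioc (add_pos hρ.1 hs) hρ.2 (by norm_num), Real.rpow_neg_one,
      Real.rpow_neg_one, div_neg, div_one, neg_sub]
  have hbeta : ∀ x ∈ Set.Ioc ρ 1, ∫⁻ s in Set.Ioi (0 : ℝ),
        ENNReal.ofReal (s ^ q) * ENNReal.ofReal ((x + s) ^ (-1 - 1 : ℝ)) =
      ENNReal.ofReal (Real.pi * q / Real.sin (Real.pi * q)) *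
        ENNReal.ofReal ((x + 0) ^ (q - 1)) := fun x hx => by
    have hx0 : 0 < x := hρ.1.trans hx.1
    have h := lintegral_rpow_mul_add_rpow_Ioi (a := 1 + q) (b := 1 - q) (by linarith)
      (by linarith) hx0
    rw [Gamma_one_add_mul_Gamma_one_sub hq0, add_sub_cancel_left, neg_sub,
      show 1 + q + (1 - q) = 2 by ring, Real.Gamma_two, div_one,
      ENNReal.ofReal_mul (pi_mul_div_sin_pos hq0 hq1).le] at h
    rw [add_zero, ← h]
    refine setLIntegral_congr_fun measurableSet_Ioi fun s (hs : 0 < s) => ?_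
    rw [← ENNReal.ofReal_mul (by positivity)]
    norm_num
  rw [setLIntegral_congr_fun measurableSet_Ioi hdiff, lintegral_lintegral_swap (by fun_prop),
    setLIntegral_congr_fun measurableSet_Ioc hbeta, lintegral_const_mul _ (by fun_prop),
    lintegral_add_rpow_Ioc (by linarith [hρ.1]) hρ.2 hq0, add_zero, add_zero, Real.one_rpow]

end GammaIntegrals

section StieltjesTransforms

variable {r : ℕ} {α β : Fin r → ℝ}

/-- Lebesgue measure on the union of the intervals `[αᵢ, βᵢ]`. -/
noncomputable def unionMeasure (α β : Fin r → ℝ) : Measure ℝ :=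
  volume.restrict (⋃ i, Set.Icc (α i) (β i))

theorem measurableSet_iUnion_Icc (α β : Fin r → ℝ) : MeasurableSet (⋃ i, Set.Icc (α i) (β i)) :=
  MeasurableSet.iUnion fun _ => measurableSet_Icc

theorem exists_forall_abs_le (α β : Fin r → ℝ) :
    ∃ ρ : ℝ, 0 ≤ ρ ∧ ∀ t ∈ ⋃ i, Set.Icc (α i) (β i), |t| ≤ ρ := by
  obtain ⟨ρ, hρ0, hρ⟩ := (isCompact_iUnion fun i : Fin r =>
    isCompact_Icc (a := α i) (b := β i)).isBounded.exists_pos_norm_le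
  exact ⟨ρ, hρ0.le, hρ⟩

theorem ae_mem_unionMeasure (α β : Fin r → ℝ) :
    ∀ᵐ t ∂(unionMeasure α β), t ∈ ⋃ i, Set.Icc (α i) (β i) :=
  ae_restrict_mem (measurableSet_iUnion_Icc α β)

theorem intervalMeasure_eq_withDensity_unionMeasure (q : ℝ) (α β : Fin r → ℝ) :
    intervalMeasure q α β = (unionMeasure α β).withDensity fun x => ENNReal.ofReal
      (Real.sin (Real.pi * q) / (Real.pi * q) * |nodalRatio α β x| ^ q) := by
  have hprod : ∀ x, ∏ i, (|x - α i| ^ (-q) * |x - β i| ^ q) = |nodalRatio α β x| ^ q := fun x => by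
    rw [nodalRatio, Finset.abs_prod, ← Real.finsetProd_rpow _ _ fun i _ => abs_nonneg _]
    refine Finset.prod_congr rfl fun i _ => ?_
    rw [abs_div, Real.div_rpow (abs_nonneg _) (abs_nonneg _), Real.rpow_neg (abs_nonneg _),
      mul_comm, div_eq_mul_inv]
  rw [unionMeasure, ← withDensity_indicator (measurableSet_iUnion_Icc α β), intervalMeasure]
  simp only [intervalDensity, hprod]
  congr 1
  ext x
  exact congrFun (Set.indicator_comp_of_zero ENNReal.ofReal_zero).symm x

theorem measurable_nodalRatio (α β : Fin r → ℝ) : Measurable (nodalRatio α β) :=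
  Finset.measurable_fun_prod _ fun _ _ => by fun_prop

theorem ae_mem_intervalMeasure (q : ℝ) (α β : Fin r → ℝ) :
    ∀ᵐ t ∂(intervalMeasure q α β), t ∈ ⋃ i, Set.Icc (α i) (β i) := by
  rw [intervalMeasure_eq_withDensity_unionMeasure]
  exact withDensity_absolutelyContinuous _ _ (ae_mem_unionMeasure α β)

theorem one_sub_rpow_div_nonneg {ρ : ℝ} (hρ : ρ ∈ Set.Ioc 0 1) (q : ℝ) : 0 ≤ (1 - ρ ^ q) / q := by
  rcases le_total q 0 with hq | hq
  · exact div_nonneg_of_nonpos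
      (sub_nonpos.2 (Real.one_le_rpow_of_pos_of_le_one_of_nonpos hρ.1 hρ.2 hq)) hq
  · exact div_nonneg (sub_nonneg.2 (Real.rpow_le_one hρ.1.le hρ.2 hq)) hq

theorem isFiniteMeasure_of_lintegral_inv_sub_ne_top {ν : Measure ℝ} {ρ w : ℝ} (hρ : 0 ≤ ρ)
    (hν : ∀ᵐ t ∂ν, |t| ≤ ρ) (hw : ρ < w) (hfin : ∫⁻ t, ENNReal.ofReal (w - t)⁻¹ ∂ν ≠ ⊤) :
    IsFiniteMeasure ν := by
  have hle : ENNReal.ofReal (w + ρ)⁻¹ * ν Set.univ ≤ ∫⁻ t, ENNReal.ofReal (w - t)⁻¹ ∂ν := by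
    rw [← lintegral_const]
    refine lintegral_mono_ae (hν.mono fun t ht => ENNReal.ofReal_le_ofReal ?_)
    obtain ⟨hlow, hhigh⟩ := abs_le.1 ht
    exact inv_anti₀ (by linarith) (by linarith)
  have hpos : ENNReal.ofReal (w + ρ)⁻¹ ≠ 0 :=
    (ENNReal.ofReal_pos.2 (inv_pos.2 (by linarith))).ne'
  exact ⟨ENNReal.lt_top_of_mul_ne_top_right (hle.trans_lt hfin.lt_top).ne hpos⟩

namespace IsIntervalSystem

theorem integral_unionMeasure (h : IsIntervalSystem α β) {g : ℝ → ℝ}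
    (hg : ∀ i, ContinuousOn g (Set.Icc (α i) (β i))) :
    ∫ t, g t ∂(unionMeasure α β) = ∑ i, ∫ t in (α i)..(β i), g t := by
  rw [unionMeasure, integral_iUnion_fintype (fun _ => measurableSet_Icc) h.pairwise_disjoint
    fun i => (hg i).integrableOn_compact isCompact_Icc]
  exact Finset.sum_congr rfl fun i _ => by
    rw [integral_Icc_eq_integral_Ioc, intervalIntegral.integral_of_le (h.1 i).le]

theorem isProbabilityMeasure_unionMeasure (h : IsIntervalSystem α β) :
    IsProbabilityMeasure (unionMeasure α β) := by
  constructor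
  rw [unionMeasure, Measure.restrict_apply_univ,
    measure_iUnion h.pairwise_disjoint (fun _ => measurableSet_Icc), tsum_fintype]
  simp only [Real.volume_Icc]
  rw [← ENNReal.ofReal_sum_of_nonneg fun i _ => sub_nonneg.2 (h.1 i).le, h.2.2,
    ENNReal.ofReal_one]

theorem integral_inv_sub_unionMeasure (h : IsIntervalSystem α β) {w : ℝ} (hw : ∀ i, β i < w) :
    ∫ t, (w - t)⁻¹ ∂(unionMeasure α β) = -Real.log (nodalRatio α β w) := by
  have hβ : ∀ i, 0 < w - β i := fun i => sub_pos.2 (hw i)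
  have hα : ∀ i, 0 < w - α i := fun i => (hβ i).trans (sub_lt_sub_left (h.1 i) w)
  have hcont : ∀ i, ContinuousOn (fun t => (w - t)⁻¹) (Set.Icc (α i) (β i)) := fun i =>
    ContinuousOn.inv₀ (by fun_prop) fun t ht => by linarith [ht.2, hβ i]
  have hterm : ∀ i, ∫ t in (α i)..(β i), (w - t)⁻¹ = Real.log ((w - α i) / (w - β i)) := fun i => by
    rw [intervalIntegral.integral_comp_sub_left fun t => t⁻¹, integral_inv_of_pos (hβ i) (hα i)]
  rw [h.integral_unionMeasure hcont, Finset.sum_congr rfl fun i _ => hterm i,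
    ← Real.log_prod fun i _ => (div_pos (hα i) (hβ i)).ne', ← Real.log_inv, nodalRatio_inv]
  rfl

theorem lintegral_inv_sub_intervalMeasure (h : IsIntervalSystem α β) {q : ℝ} (hq0 : q ≠ 0)
    (hq1 : |q| < 1) {w : ℝ} (hw : ∀ i, β i < w) :
    ∫⁻ t, ENNReal.ofReal (w - t)⁻¹ ∂(intervalMeasure q α β) =
      ENNReal.ofReal ((1 - nodalRatio α β w ^ q) / q) := by
  set c := Real.sin (Real.pi * q) / (Real.pi * q) with hc
  have hcpos : 0 < c := by
    rw [hc, ← inv_div]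
    exact inv_pos.2 (pi_mul_div_sin_pos hq0 hq1)
  have hR := measurable_nodalRatio α β
  have hbranch : ∀ i, ∫⁻ x in Set.Icc (α i) (β i),
        ENNReal.ofReal (c * |nodalRatio α β x| ^ q) * ENNReal.ofReal (w - x)⁻¹ =
      ENNReal.ofReal c * ∫⁻ x in Set.Ioo (α i) (β i),
        ENNReal.ofReal ((-nodalRatio α β x) ^ q) * ENNReal.ofReal (w - x)⁻¹ := fun i => by
    rw [← setLIntegral_congr Ioo_ae_eq_Icc, ← lintegral_const_mul' _ _ ENNReal.ofReal_ne_top]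
    refine setLIntegral_congr_fun measurableSet_Ioo fun x hx => ?_
    rw [ENNReal.ofReal_mul hcpos.le, mul_assoc, abs_of_neg (h.nodalRatio_neg hx)]
  rw [intervalMeasure_eq_withDensity_unionMeasure,
    lintegral_withDensity_eq_lintegral_mul _ (by fun_prop) (by fun_prop), unionMeasure,
    lintegral_iUnion (fun _ => measurableSet_Icc) h.pairwise_disjoint, tsum_fintype]
  simp only [Pi.mul_apply]
  rw [Finset.sum_congr rfl fun i _ => hbranch i, ← Finset.mul_sum,
    h.sum_lintegral_comp_neg_nodalRatio_div hw
      (φ := fun s => ENNReal.ofReal (s ^ q)) (by fun_prop),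
    lintegral_rpow_mul_inv_sub_inv_Ioi hq0 hq1 (h.nodalRatio_mem_Ioc hw),
    ← mul_assoc, ← ENNReal.ofReal_mul hcpos.le, ← inv_div (Real.sin _),
    mul_inv_cancel₀ hcpos.ne', ENNReal.ofReal_one, one_mul]

theorem integral_inv_sub_intervalMeasure (h : IsIntervalSystem α β) {q : ℝ} (hq0 : q ≠ 0)
    (hq1 : |q| < 1) {w : ℝ} (hw : ∀ i, β i < w) :
    ∫ t, (w - t)⁻¹ ∂(intervalMeasure q α β) = (1 - nodalRatio α β w ^ q) / q := by
  rw [integral_eq_lintegral_of_nonneg_ae _ (by fun_prop),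
    h.lintegral_inv_sub_intervalMeasure hq0 hq1 hw,
    ENNReal.toReal_ofReal (one_sub_rpow_div_nonneg (h.nodalRatio_mem_Ioc hw) q)]
  refine (ae_mem_intervalMeasure q α β).mono fun t ht => ?_
  obtain ⟨i, hi⟩ := Set.mem_iUnion.1 ht
  exact inv_nonneg.2 (sub_nonneg.2 (hi.2.trans (hw i).le))

theorem exp_integral_inv_sub (h : IsIntervalSystem α β) {q : ℝ} (hq0 : q ≠ 0) (hq1 : |q| < 1)
    {w : ℝ} (hw : ∀ i, β i < w) :
    Real.exp (-q * ∫ t, (w - t)⁻¹ ∂(unionMeasure α β)) =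
      1 - q * ∫ t, (w - t)⁻¹ ∂(intervalMeasure q α β) := by
  rw [h.integral_inv_sub_unionMeasure hw, h.integral_inv_sub_intervalMeasure hq0 hq1 hw,
    neg_mul_neg, mul_comm, ← Real.rpow_def_of_pos (h.nodalRatio_mem_Ioc hw).1,
    mul_div_cancel₀ _ hq0, sub_sub_cancel]

theorem right_le_of_forall_abs_le (h : IsIntervalSystem α β) {ρ : ℝ}
    (hρ : ∀ t ∈ ⋃ i, Set.Icc (α i) (β i), |t| ≤ ρ) (i : Fin r) : β i ≤ ρ :=
  (le_abs_self _).trans (hρ _ (Set.mem_iUnion.2 ⟨i, Set.right_mem_Icc.2 (h.1 i).le⟩))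

theorem isFiniteMeasure_intervalMeasure (h : IsIntervalSystem α β) {q : ℝ} (hq0 : q ≠ 0)
    (hq1 : |q| < 1) : IsFiniteMeasure (intervalMeasure q α β) := by
  obtain ⟨ρ, hρ0, hρ⟩ := exists_forall_abs_le α β
  refine isFiniteMeasure_of_lintegral_inv_sub_ne_top hρ0
    ((ae_mem_intervalMeasure q α β).mono hρ) (lt_add_one ρ) ?_
  rw [h.lintegral_inv_sub_intervalMeasure hq0 hq1 fun i =>
    (h.right_le_of_forall_abs_le hρ i).trans_lt (lt_add_one ρ)]
  exact ENNReal.ofReal_ne_top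

end IsIntervalSystem

end StieltjesTransforms

section MomentTransform

variable {μ ν : Measure ℝ} [IsFiniteMeasure μ] [IsFiniteMeasure ν] {ρ : ℝ}

/-- The sum `∫ z / (1 - t z) dν(t)` of the series `∑ₖ νₖ z ^ (k + 1)`. Unlike `momentSeries`, it
does not presuppose that the total mass of `ν` is one. -/
noncomputable def momentTransform (ν : Measure ℝ) (z : ℂ) : ℂ := ∫ t : ℝ, z / (1 - t * z) ∂ν

theorem momentTransform_zero (ν : Measure ℝ) : momentTransform ν 0 = 0 := by
  simp [momentTransform]

theorem momentTransform_ofReal_inv (ν : Measure ℝ) {w : ℝ} (hw : w ≠ 0) :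
    momentTransform ν (w⁻¹ : ℝ) = (∫ t, (w - t)⁻¹ ∂ν : ℝ) := by
  rw [momentTransform, ← integral_complex_ofReal]
  congr 1
  ext t
  rw [← div_mul_cancel₀ (w - t) hw, sub_div, div_self hw, mul_inv, div_eq_mul_inv t]
  push_cast
  ring

theorem hasSum_momentTransform (hρ : 0 ≤ ρ) (hν : ∀ᵐ t ∂ν, |t| ≤ ρ) {z : ℂ} (hz : ρ * ‖z‖ < 1) :
    HasSum (fun k : ℕ => ((∫ t, t ^ k ∂ν : ℝ) : ℂ) * z ^ (k + 1)) (momentTransform ν z) := by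
  have hterm : ∀ k : ℕ, ((∫ t, t ^ k ∂ν : ℝ) : ℂ) * z ^ (k + 1) =
      ∫ t : ℝ, z * (t * z) ^ k ∂ν := fun k => by
    rw [← integral_complex_ofReal, ← integral_mul_const]
    congr 1
    ext t
    push_cast
    ring
  simp only [hterm]
  refine hasSum_integral_of_dominated_convergence (fun k _ => ‖z‖ * (ρ * ‖z‖) ^ k)
    (fun k => (by fun_prop : Continuous _).aestronglyMeasurable) (fun k => hν.mono fun t ht => ?_)
    (.of_forall fun _ => (summable_geometric_of_lt_one (by positivity) hz).mul_left _)
    (integrable_const _) (hν.mono fun t ht => ?_)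
  · rw [norm_mul, norm_pow, norm_mul, Complex.norm_real, Real.norm_eq_abs]
    gcongr
  · refine (hasSum_geometric_of_norm_lt_one ?_).mul_left z
    rw [norm_mul, Complex.norm_real, Real.norm_eq_abs]
    exact (mul_le_mul_of_nonneg_right ht (norm_nonneg z)).trans_lt hz

theorem eventually_hasSum_momentTransform (hρ : 0 ≤ ρ) (hν : ∀ᵐ t ∂ν, |t| ≤ ρ) :
    ∀ᶠ z in 𝓝 (0 : ℂ),
      HasSum (fun k : ℕ => ((∫ t, t ^ k ∂ν : ℝ) : ℂ) * z ^ (k + 1)) (momentTransform ν z) := by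
  have hlim : Tendsto (fun z : ℂ => ρ * ‖z‖) (𝓝 0) (𝓝 0) :=
    (by fun_prop : Continuous fun z : ℂ => ρ * ‖z‖).tendsto' _ _ (by simp)
  exact (hlim.eventually_lt_const one_pos).mono fun z hz => hasSum_momentTransform hρ hν hz

theorem momentSeries_eventuallyEq (ν : ProbabilityMeasure ℝ) (hρ : 0 ≤ ρ)
    (hν : ∀ᵐ t ∂(ν : Measure ℝ), |t| ≤ ρ) :
    momentSeries ν =ᶠ[𝓝 0] momentTransform ν :=
  (eventually_hasSum_momentTransform hρ hν).mono fun _ hz => hz.tsum_eq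

theorem hasFPowerSeriesAt_momentTransform (hρ : 0 ≤ ρ) (hν : ∀ᵐ t ∂ν, |t| ≤ ρ) :
    HasFPowerSeriesAt (momentTransform ν) (FormalMultilinearSeries.ofScalars ℂ fun n =>
      if n = 0 then 0 else ((∫ t, t ^ (n - 1) ∂ν : ℝ) : ℂ)) 0 := by
  rw [hasFPowerSeriesAt_iff]
  filter_upwards [eventually_hasSum_momentTransform hρ hν] with z hz
  rw [zero_add, ← hasSum_nat_add_iff' 1]
  simpa [mul_comm] using hz

theorem analyticAt_momentTransform (hρ : 0 ≤ ρ) (hν : ∀ᵐ t ∂ν, |t| ≤ ρ) :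
    AnalyticAt ℂ (momentTransform ν) 0 :=
  (hasFPowerSeriesAt_momentTransform hρ hν).analyticAt

theorem iteratedDeriv_momentTransform (hρ : 0 ≤ ρ) (hν : ∀ᵐ t ∂ν, |t| ≤ ρ) (k : ℕ) :
    iteratedDeriv (k + 1) (momentTransform ν) 0 =
      (k + 1).factorial * ((∫ t, t ^ k ∂ν : ℝ) : ℂ) := by
  have hseries := hasFPowerSeriesAt_momentTransform hρ hν
  have hcoeff := congrArg (fun p => p.coeff (k + 1))
    (hseries.eq_formalMultilinearSeries hseries.analyticAt.hasFPowerSeriesAt)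
  simp only [FormalMultilinearSeries.coeff_ofScalars, Nat.add_one_ne_zero, if_false,
    Nat.add_sub_cancel] at hcoeff
  rw [hcoeff, mul_div_cancel₀ _ (Nat.cast_ne_zero.2 (k + 1).factorial_ne_zero)]

theorem eventually_exp_momentTransform_of_real {q : ℝ} (hρ : 0 ≤ ρ) (hμ : ∀ᵐ t ∂μ, |t| ≤ ρ)
    (hν : ∀ᵐ t ∂ν, |t| ≤ ρ)
    (h : ∀ᶠ w : ℝ in atTop,
      Real.exp (-q * ∫ t, (w - t)⁻¹ ∂μ) = 1 - q * ∫ t, (w - t)⁻¹ ∂ν) :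
    ∀ᶠ z in 𝓝 (0 : ℂ),
      Complex.exp (-(q : ℂ) * momentTransform μ z) = 1 - (q : ℂ) * momentTransform ν z := by
  refine (AnalyticAt.frequently_eq_iff_eventually_eq
    (analyticAt_const.mul (analyticAt_momentTransform hρ hμ)).cexp
    (analyticAt_const.sub (analyticAt_const.mul (analyticAt_momentTransform hρ hν)))).1 ?_
  have hlim : Tendsto (fun w : ℝ => ((w⁻¹ : ℝ) : ℂ)) atTop (𝓝[≠] 0) := by
    refine tendsto_nhdsWithin_iff.2
      ⟨(Complex.continuous_ofReal.tendsto' 0 0 Complex.ofReal_zero).comp tendsto_inv_atTop_zero, ?_⟩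
    filter_upwards [eventually_ne_atTop 0] with w hw
    exact Complex.ofReal_ne_zero.2 (inv_ne_zero hw)
  refine hlim.frequently (Eventually.frequently ?_)
  filter_upwards [h, eventually_ne_atTop 0] with w hexp hw
  change Complex.exp (-(q : ℂ) * momentTransform μ _) = 1 - (q : ℂ) * momentTransform ν _
  rw [momentTransform_ofReal_inv μ hw, momentTransform_ofReal_inv ν hw]
  exact_mod_cast congrArg Complex.ofReal hexp

theorem iteratedDeriv_cexp_comp_succ {L : ℂ → ℂ} {z₀ : ℂ} (hL : AnalyticAt ℂ L z₀) (n : ℕ) :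
    iteratedDeriv (n + 1) (fun z => Complex.exp (L z)) z₀ =
      ∑ i ∈ Finset.range (n + 1), n.choose i * iteratedDeriv (i + 1) L z₀ *
        iteratedDeriv (n - i) (fun z => Complex.exp (L z)) z₀ := by
  have hderiv : deriv (fun z => Complex.exp (L z)) =ᶠ[𝓝 z₀]
      deriv L * fun z => Complex.exp (L z) := by
    filter_upwards [hL.eventually_analyticAt] with z hz
    rw [hz.differentiableAt.hasDerivAt.cexp.deriv, Pi.mul_apply, mul_comm]
  rw [iteratedDeriv_succ', hderiv.iteratedDeriv_eq,
    iteratedDeriv_mul hL.deriv.contDiffAt hL.cexp'.contDiffAt]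
  simp only [iteratedDeriv_succ']

/-- The relation `exp (-q ∑ₖ aₖ z ^ (k + 1)) = 1 - q ∑ₖ bₖ z ^ (k + 1)`, differentiated and written
in terms of coefficients: it determines each `bₖ` as a polynomial in `a₀, …, aₖ`. -/
def MarkovKreinRecursion {K : Type*} [CommRing K] (q : K) (a b : ℕ → K) : Prop :=
  ∀ k : ℕ, (k + 1) * b k =
    (k + 1) * a k - q * ∑ i ∈ Finset.range k, (i + 1) * a i * b (k - 1 - i)

theorem markovKreinRecursion_of_sum_choose {K : Type*} [Field K] [CharZero K] {q : K} (hq : q ≠ 0)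
    {a b e : ℕ → K} (he_zero : e 0 = 1) (he_succ : ∀ n, e (n + 1) = -q * ((n + 1).factorial * b n))
    (he : ∀ n, e (n + 1) = ∑ i ∈ Finset.range (n + 1),
      n.choose i * (-q * ((i + 1).factorial * a i)) * e (n - i)) :
    MarkovKreinRecursion q a b := by
  intro n
  have hterm : ∀ i ∈ Finset.range n, n.choose i * (-q * ((i + 1).factorial * a i)) * e (n - i) =
      -q * n.factorial * (-q * ((i + 1) * a i * b (n - 1 - i))) := by
    intro i hi
    have hin := Finset.mem_range.1 hi
    have hchoose : (n.factorial : K) = n.choose i * i.factorial * (n - i).factorial :=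
      mod_cast (Nat.choose_mul_factorial_mul_factorial hin.le).symm
    rw [show n - i = n - 1 - i + 1 by lia, he_succ, ← show n - i = n - 1 - i + 1 by lia, hchoose,
      Nat.factorial_succ]
    push_cast
    ring
  have hn := he n
  rw [he_succ, Finset.sum_range_succ, Finset.sum_congr rfl hterm, ← Finset.mul_sum,
    ← Finset.mul_sum, Nat.choose_self, Nat.sub_self, he_zero, Nat.factorial_succ] at hn
  refine mul_left_cancel₀ (a := -q * n.factorial)
    (mul_ne_zero (neg_ne_zero.2 hq) (Nat.cast_ne_zero.2 n.factorial_ne_zero)) ?_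
  push_cast at hn
  linear_combination hn

theorem markovKreinRecursion_of_exp_eq {q : ℝ} (hq : q ≠ 0) (hρ : 0 ≤ ρ) (hμ : ∀ᵐ t ∂μ, |t| ≤ ρ)
    (hν : ∀ᵐ t ∂ν, |t| ≤ ρ)
    (h : ∀ᶠ z in 𝓝 (0 : ℂ),
      Complex.exp (-(q : ℂ) * momentTransform μ z) = 1 - (q : ℂ) * momentTransform ν z) :
    MarkovKreinRecursion q (fun k => ∫ t, t ^ k ∂μ) (fun k => ∫ t, t ^ k ∂ν) := by
  have hL : AnalyticAt ℂ (fun z => -(q : ℂ) * momentTransform μ z) 0 :=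
    analyticAt_const.mul (analyticAt_momentTransform hρ hμ)
  have hcomplex : MarkovKreinRecursion (q : ℂ) (fun k => ((∫ t, t ^ k ∂μ : ℝ) : ℂ))
      (fun k => ((∫ t, t ^ k ∂ν : ℝ) : ℂ)) := by
    refine markovKreinRecursion_of_sum_choose (Complex.ofReal_ne_zero.2 hq)
      (e := fun n => iteratedDeriv n (fun z => Complex.exp (-(q : ℂ) * momentTransform μ z)) 0)
      ?_ (fun n => ?_) (fun n => ?_)
    · rw [iteratedDeriv_zero, momentTransform_zero, mul_zero, Complex.exp_zero]
    · rw [EventuallyEq.iteratedDeriv_eq _ h, iteratedDeriv_const_sub n.succ_pos, iteratedDeriv_neg,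
        iteratedDeriv_const_mul_field, iteratedDeriv_momentTransform hρ hν, neg_mul]
    · simp only [iteratedDeriv_cexp_comp_succ hL, iteratedDeriv_const_mul_field,
        iteratedDeriv_momentTransform hρ hμ]
  intro k
  have hk := hcomplex k
  beta_reduce at hk ⊢
  exact_mod_cast hk

theorem MarkovKreinRecursion.tendsto {q : ℝ} {a b : ℕ → ℕ → ℝ} {a' b' : ℕ → ℝ}
    (h : ∀ n, MarkovKreinRecursion q (a n) (b n)) (h' : MarkovKreinRecursion q a' b')
    (ha : ∀ k, Tendsto (fun n => a n k) atTop (𝓝 (a' k))) (k : ℕ) :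
    Tendsto (fun n => b n k) atTop (𝓝 (b' k)) := by
  induction k using Nat.strong_induction_on with
  | _ k ih =>
    have hk : (k + 1 : ℝ) ≠ 0 := k.cast_add_one_ne_zero
    have hlim : Tendsto (fun n => (k + 1) * b n k) atTop (𝓝 ((k + 1) * b' k)) := by
      rw [h' k]
      simp only [fun n => h n k]
      refine ((ha k).const_mul _).sub ((tendsto_finsetSum _ fun i hi => ?_).const_mul q)
      exact ((ha i).const_mul _).mul (ih _ (by have := Finset.mem_range.1 hi; lia))
    simpa only [inv_mul_cancel_left₀ hk] using hlim.const_mul (k + 1 : ℝ)⁻¹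

end MomentTransform

section MarkovKreinMap

theorem exists_ae_abs_le_of_isCompact_support {ν : Measure ℝ} (h : IsCompact ν.support) :
    ∃ ρ : ℝ, 0 < ρ ∧ ∀ᵐ t ∂ν, |t| ≤ ρ := by
  obtain ⟨ρ, hρ0, hρ⟩ := h.isBounded.exists_pos_norm_le
  exact ⟨ρ, hρ0, Filter.mem_of_superset Measure.support_mem_ae hρ⟩

theorem isCompact_support_of_ae_mem {ν : Measure ℝ} {K : Set ℝ} (hK : IsCompact K)
    (h : ∀ᵐ t ∂ν, t ∈ K) : IsCompact ν.support :=
  hK.of_isClosed_subset Measure.isClosed_support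
    (Measure.support_subset_of_isClosed hK.isClosed h)

theorem isMarkovKrein_iff {q ρ : ℝ} (hρ : 0 ≤ ρ) {μ ν : ProbabilityMeasure ℝ}
    (hμ : ∀ᵐ t ∂(μ : Measure ℝ), |t| ≤ ρ) (hν : ∀ᵐ t ∂(ν : Measure ℝ), |t| ≤ ρ) :
    IsMarkovKrein q μ ν ↔ μ ∈ BoundedDensity (1 / |q|) ∧ ∀ᶠ z in 𝓝 (0 : ℂ),
      Complex.exp (-(q : ℂ) * momentTransform μ z) = 1 - (q : ℂ) * momentTransform ν z := by
  have hcompact : IsCompact (ν : Measure ℝ).support :=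
    isCompact_support_of_ae_mem isCompact_Icc (hν.mono fun t ht => abs_le.1 ht)
  have hcongr : (∀ᶠ z in 𝓝 (0 : ℂ),
        Complex.exp (-(q : ℂ) * momentSeries μ z) = 1 - (q : ℂ) * momentSeries ν z) ↔
      ∀ᶠ z in 𝓝 (0 : ℂ),
        Complex.exp (-(q : ℂ) * momentTransform μ z) = 1 - (q : ℂ) * momentTransform ν z := by
    refine eventually_congr ?_
    filter_upwards [momentSeries_eventuallyEq μ hρ hμ, momentSeries_eventuallyEq ν hρ hν]
      with z hzμ hzν
    rw [hzμ, hzν]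
  rw [IsMarkovKrein, hcongr]
  tauto

theorem IsMarkovKrein.markovKreinRecursion {q : ℝ} (hq : q ≠ 0) {μ ν : ProbabilityMeasure ℝ}
    (h : IsMarkovKrein q μ ν) :
    MarkovKreinRecursion q (fun k => ∫ t, t ^ k ∂(μ : Measure ℝ))
      (fun k => ∫ t, t ^ k ∂(ν : Measure ℝ)) := by
  obtain ⟨ρ, hρ0, hρ⟩ := exists_ae_abs_le_of_isCompact_support h.1.1
  obtain ⟨σ, -, hσ⟩ := exists_ae_abs_le_of_isCompact_support h.2.1
  have hmax : 0 ≤ max ρ σ := hρ0.le.trans (le_max_left _ _)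
  have hμ : ∀ᵐ t ∂(μ : Measure ℝ), |t| ≤ max ρ σ := hρ.mono fun t ht => ht.trans (le_max_left _ _)
  have hν : ∀ᵐ t ∂(ν : Measure ℝ), |t| ≤ max ρ σ := hσ.mono fun t ht => ht.trans (le_max_right _ _)
  exact markovKreinRecursion_of_exp_eq hq hmax hμ hν ((isMarkovKrein_iff hmax hμ hν).1 h).2

theorem boundedDensity_mono {c d : ℝ} (h : c ≤ d) : BoundedDensity c ⊆ BoundedDensity d :=
  fun _ ⟨hμ, f, hf, hfc, hμf⟩ => ⟨hμ, f, hf, fun x => ⟨(hfc x).1, (hfc x).2.trans h⟩, hμf⟩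

namespace IsIntervalSystem

variable {r : ℕ} {α β : Fin r → ℝ} {q : ℝ}

theorem eventually_exp_momentTransform (h : IsIntervalSystem α β) (hq0 : q ≠ 0) (hq1 : |q| < 1) :
    ∀ᶠ z in 𝓝 (0 : ℂ), Complex.exp (-(q : ℂ) * momentTransform (unionMeasure α β) z) =
      1 - (q : ℂ) * momentTransform (intervalMeasure q α β) z := by
  have := h.isProbabilityMeasure_unionMeasure
  have := h.isFiniteMeasure_intervalMeasure hq0 hq1
  obtain ⟨ρ, hρ0, hρ⟩ := exists_forall_abs_le α β
  refine eventually_exp_momentTransform_of_real hρ0 ((ae_mem_unionMeasure α β).mono hρ)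
    ((ae_mem_intervalMeasure q α β).mono hρ) ?_
  filter_upwards [eventually_gt_atTop ρ] with w hw
  exact h.exp_integral_inv_sub hq0 hq1 fun i => (h.right_le_of_forall_abs_le hρ i).trans_lt hw

theorem markovKreinRecursion (h : IsIntervalSystem α β) (hq0 : q ≠ 0) (hq1 : |q| < 1) :
    MarkovKreinRecursion q (fun k => ∫ t, t ^ k ∂(unionMeasure α β))
      (fun k => ∫ t, t ^ k ∂(intervalMeasure q α β)) := by
  have := h.isProbabilityMeasure_unionMeasure
  have := h.isFiniteMeasure_intervalMeasure hq0 hq1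
  obtain ⟨ρ, hρ0, hρ⟩ := exists_forall_abs_le α β
  exact markovKreinRecursion_of_exp_eq hq0 hρ0 ((ae_mem_unionMeasure α β).mono hρ)
    ((ae_mem_intervalMeasure q α β).mono hρ) (h.eventually_exp_momentTransform hq0 hq1)

theorem isProbabilityMeasure_intervalMeasure (h : IsIntervalSystem α β) (hq0 : q ≠ 0)
    (hq1 : |q| < 1) : IsProbabilityMeasure (intervalMeasure q α β) := by
  have := h.isProbabilityMeasure_unionMeasure
  have hmass := h.markovKreinRecursion hq0 hq1 0
  simp only [pow_zero, integral_const, probReal_univ, Finset.range_zero, Finset.sum_empty, mul_zero,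
    sub_zero, Nat.cast_zero, zero_add, one_mul, smul_eq_mul, mul_one] at hmass
  exact ⟨(ENNReal.toReal_eq_one_iff _).1 hmass⟩

theorem unionMeasure_mem_boundedDensity (h : IsIntervalSystem α β) :
    (⟨unionMeasure α β, h.isProbabilityMeasure_unionMeasure⟩ : ProbabilityMeasure ℝ) ∈
      BoundedDensity 1 := by
  have hmeas := measurableSet_iUnion_Icc α β
  refine ⟨isCompact_support_of_ae_mem (isCompact_iUnion fun _ => isCompact_Icc)
    (ae_mem_unionMeasure α β), (⋃ i, Set.Icc (α i) (β i)).indicator 1,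
    measurable_one.indicator hmeas, fun x => ⟨Set.indicator_nonneg (fun _ _ => zero_le_one) x,
      Set.indicator_le_self' (fun _ _ => zero_le_one) x⟩, ?_⟩
  rw [ProbabilityMeasure.coe_mk, unionMeasure, ← withDensity_indicator_one hmeas]
  congr 1
  ext x
  simp only [Set.indicator, apply_ite ENNReal.ofReal, Pi.one_apply, ENNReal.ofReal_one,
    ENNReal.ofReal_zero]

theorem isMarkovKrein (h : IsIntervalSystem α β) (hq0 : q ≠ 0) (hq1 : |q| < 1) :
    IsMarkovKrein q ⟨unionMeasure α β, h.isProbabilityMeasure_unionMeasure⟩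
      ⟨intervalMeasure q α β, h.isProbabilityMeasure_intervalMeasure hq0 hq1⟩ := by
  obtain ⟨ρ, hρ0, hρ⟩ := exists_forall_abs_le α β
  refine (isMarkovKrein_iff hρ0 ?_ ?_).2
    ⟨boundedDensity_mono ((one_le_div (abs_pos.2 hq0)).2 hq1.le) h.unionMeasure_mem_boundedDensity,
      h.eventually_exp_momentTransform hq0 hq1⟩
  · exact (ae_mem_unionMeasure α β).mono hρ
  · exact (ae_mem_intervalMeasure q α β).mono hρ

end IsIntervalSystem

theorem intervalFamily_subset_markovKreinImage {q : ℝ} (hq0 : q ≠ 0) (hq1 : |q| < 1) :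
    intervalFamily q ⊆ markovKreinImage q (BoundedDensity 1) := by
  rintro ν ⟨r, α, β, h, hν⟩
  obtain rfl : ν = ⟨intervalMeasure q α β, h.isProbabilityMeasure_intervalMeasure hq0 hq1⟩ :=
    Subtype.ext hν
  exact ⟨_, h.unionMeasure_mem_boundedDensity, h.isMarkovKrein hq0 hq1⟩

end MarkovKreinMap

section WeakConvergence

theorem hasSum_charFun {ν : Measure ℝ} [IsFiniteMeasure ν] {ρ : ℝ} (hν : ∀ᵐ x ∂ν, |x| ≤ ρ) (t : ℝ) :
    HasSum (fun k : ℕ => (t * Complex.I) ^ k / k.factorial * ((∫ x, x ^ k ∂ν : ℝ) : ℂ))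
      (charFun ν t) := by
  have hterm : ∀ k : ℕ, (t * Complex.I) ^ k / k.factorial * ((∫ x, x ^ k ∂ν : ℝ) : ℂ) =
      ∫ x : ℝ, (t * x * Complex.I) ^ k / k.factorial ∂ν := fun k => by
    rw [← integral_complex_ofReal, ← integral_const_mul]
    congr 1
    ext x
    push_cast
    ring
  rw [charFun_apply_real]
  simp only [hterm]
  refine hasSum_integral_of_dominated_convergence (fun k _ => (|t| * ρ) ^ k / k.factorial)
    (fun k => (by fun_prop : Continuous _).aestronglyMeasurable) (fun k => hν.mono fun x hx => ?_)
    (.of_forall fun _ => Real.summable_pow_div_factorial _) (integrable_const _)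
    (.of_forall fun x => ?_)
  · rw [norm_div, norm_pow, norm_mul, norm_mul, Complex.norm_I, mul_one, Complex.norm_real,
      Complex.norm_real, Complex.norm_natCast, Real.norm_eq_abs, Real.norm_eq_abs]
    gcongr
  · rw [Complex.exp_eq_exp_ℂ]
    exact NormedSpace.expSeries_div_hasSum_exp (𝔸 := ℂ) _

theorem abs_integral_pow_le {ν : Measure ℝ} [IsProbabilityMeasure ν] {ρ : ℝ}
    (hν : ∀ᵐ x ∂ν, |x| ≤ ρ) (k : ℕ) : |∫ x, x ^ k ∂ν| ≤ ρ ^ k := by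
  have hbound := norm_integral_le_of_norm_le_const (f := fun x : ℝ => x ^ k) (C := ρ ^ k)
    (hν.mono fun x hx => by rw [norm_pow, Real.norm_eq_abs]; gcongr)
  rwa [probReal_univ, mul_one] at hbound

theorem tendsto_of_tendsto_integral_pow {u : ℕ → ProbabilityMeasure ℝ} {ν : ProbabilityMeasure ℝ}
    {ρ : ℝ} (hu : ∀ n, ∀ᵐ x ∂(u n : Measure ℝ), |x| ≤ ρ) (hν : ∀ᵐ x ∂(ν : Measure ℝ), |x| ≤ ρ)
    (h : ∀ k : ℕ, Tendsto (fun n => ∫ x : ℝ, x ^ k ∂(u n : Measure ℝ)) atTop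
      (𝓝 (∫ x : ℝ, x ^ k ∂(ν : Measure ℝ)))) :
    Tendsto u atTop (𝓝 ν) := by
  refine ProbabilityMeasure.tendsto_iff_tendsto_charFun.2 fun t => ?_
  rw [← (hasSum_charFun hν t).tsum_eq]
  simp only [← (hasSum_charFun (hu _) t).tsum_eq]
  refine tendsto_tsum_of_dominated_convergence (Real.summable_pow_div_factorial (|t| * ρ))
    (fun k => ((Complex.continuous_ofReal.tendsto _).comp (h k)).const_mul _)
    (.of_forall fun n k => ?_)
  rw [norm_mul, norm_div, norm_pow, norm_mul, Complex.norm_I, mul_one, Complex.norm_real,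
    Complex.norm_real, Complex.norm_natCast, Real.norm_eq_abs, Real.norm_eq_abs, mul_pow,
    mul_div_right_comm]
  gcongr
  exact abs_integral_pow_le (hu n) k

end WeakConvergence

section CellApproximation

theorem abs_integral_mul_sub_le {a b c ω : ℝ} {w φ : ℝ → ℝ} (hab : a ≤ b)
    (hw : IntervalIntegrable w volume a b) (hw0 : ∀ t, 0 ≤ w t) (hφ : Continuous φ)
    (hω : ∀ t ∈ Set.Icc a b, |φ t - c| ≤ ω) :
    |(∫ t in a..b, w t * φ t) - c * ∫ t in a..b, w t| ≤ ω * ∫ t in a..b, w t := by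
  rw [← intervalIntegral.integral_const_mul, ← intervalIntegral.integral_const_mul,
    ← intervalIntegral.integral_sub (hw.mul_continuousOn hφ.continuousOn) (hw.const_mul c),
    ← Real.norm_eq_abs]
  refine intervalIntegral.norm_integral_le_of_norm_le hab (.of_forall fun t ht => ?_)
    (hw.const_mul ω)
  rw [mul_comm c, ← mul_sub, norm_mul, Real.norm_eq_abs, Real.norm_eq_abs, abs_of_nonneg (hw0 t),
    mul_comm]
  exact mul_le_mul_of_nonneg_right (hω t (Set.Ioc_subset_Icc_self ht)) (hw0 t)

variable {g φ : ℝ → ℝ} {p : ℕ → ℝ} {m : ℕ}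

/-- The right endpoint of the interval that starts at `p j` and has as length the mass that the
density `g` puts on the cell `[p j, p (j + 1)]`. -/
noncomputable def massEndpoint (g : ℝ → ℝ) (p : ℕ → ℝ) (j : ℕ) : ℝ :=
  p j + ∫ t in (p j)..(p (j + 1)), g t

theorem massEndpoint_mem_Ioo (hg : ∀ a b, IntervalIntegrable g volume a b)
    (hg01 : ∀ t, g t ∈ Set.Ioo (0 : ℝ) 1) (hp : StrictMono p) (j : ℕ) :
    massEndpoint g p j ∈ Set.Ioo (p j) (p (j + 1)) := by
  have hlt : p j < p (j + 1) := hp j.lt_succ_self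
  have hpos := intervalIntegral.intervalIntegral_pos_of_pos (hg _ _) (fun t => (hg01 t).1) hlt
  have hdeficit := intervalIntegral.intervalIntegral_pos_of_pos
    (intervalIntegrable_const.sub (hg _ _)) (fun t => sub_pos.2 (hg01 t).2) hlt
  rw [intervalIntegral.integral_sub intervalIntegrable_const (hg _ _),
    intervalIntegral.integral_const, smul_eq_mul, mul_one] at hdeficit
  exact ⟨lt_add_of_pos_right _ hpos, by rw [massEndpoint]; linarith⟩

theorem isIntervalSystem_massEndpoint (hg : ∀ a b, IntervalIntegrable g volume a b)
    (hg01 : ∀ t, g t ∈ Set.Ioo (0 : ℝ) 1) (hp : StrictMono p)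
    (hmass : ∫ t in (p 0)..(p m), g t = 1) :
    IsIntervalSystem (fun j : Fin m => p j) (fun j : Fin m => massEndpoint g p j) := by
  refine ⟨fun j => (massEndpoint_mem_Ioo hg hg01 hp j).1, fun i j hij => ?_, ?_⟩
  · exact (massEndpoint_mem_Ioo hg hg01 hp i).2.trans_le (hp.monotone (Nat.succ_le_of_lt hij))
  · simp only [massEndpoint, add_sub_cancel_left]
    rw [← Finset.sum_range fun j => ∫ t in (p j)..(p (j + 1)), g t,
      intervalIntegral.sum_integral_adjacent_intervals fun j _ => hg _ _, hmass]

theorem abs_integral_massEndpoint_sub_le (hg : ∀ a b, IntervalIntegrable g volume a b)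
    (hg01 : ∀ t, g t ∈ Set.Ioo (0 : ℝ) 1) (hp : StrictMono p) (hφ : Continuous φ) {ω : ℝ} {j : ℕ}
    (hω : ∀ t ∈ Set.Icc (p j) (p (j + 1)), |φ t - φ (p j)| ≤ ω) :
    |(∫ t in (p j)..(massEndpoint g p j), φ t) - ∫ t in (p j)..(p (j + 1)), g t * φ t| ≤
      2 * ω * ∫ t in (p j)..(p (j + 1)), g t := by
  obtain ⟨hleft, hright⟩ := massEndpoint_mem_Ioo hg hg01 hp j
  have hinterval := abs_integral_mul_sub_le hleft.le (intervalIntegrable_const (c := (1 : ℝ)))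
    (fun _ => zero_le_one) hφ fun t ht => hω t ⟨ht.1, ht.2.trans hright.le⟩
  have hcell := abs_integral_mul_sub_le (hp j.lt_succ_self).le (hg _ _) (fun t => (hg01 t).1.le) hφ
    hω
  simp only [one_mul, intervalIntegral.integral_const, smul_eq_mul, mul_one] at hinterval
  rw [massEndpoint, add_sub_cancel_left, ← massEndpoint] at hinterval
  rw [abs_sub_comm] at hcell
  refine (abs_sub_le _ (φ (p j) * ∫ t in (p j)..(p (j + 1)), g t) _).trans ?_
  linarith

theorem abs_integral_unionMeasure_sub_le (hg : ∀ a b, IntervalIntegrable g volume a b)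
    (hg01 : ∀ t, g t ∈ Set.Ioo (0 : ℝ) 1) (hp : StrictMono p)
    (hmass : ∫ t in (p 0)..(p m), g t = 1) (hφ : Continuous φ) {ω : ℝ}
    (hω : ∀ j < m, ∀ t ∈ Set.Icc (p j) (p (j + 1)), |φ t - φ (p j)| ≤ ω) :
    |(∫ t, φ t ∂(unionMeasure (fun j : Fin m => p j) fun j : Fin m => massEndpoint g p j)) -
      ∫ t in (p 0)..(p m), g t * φ t| ≤ 2 * ω := by
  have hsystem := isIntervalSystem_massEndpoint hg hg01 hp hmass
  rw [hsystem.integral_unionMeasure fun _ => hφ.continuousOn,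
    ← intervalIntegral.sum_integral_adjacent_intervals fun j _ =>
      (hg _ _).mul_continuousOn hφ.continuousOn, Finset.sum_range, ← Finset.sum_sub_distrib]
  calc _ ≤ ∑ j : Fin m, 2 * ω * ∫ t in (p j)..(p (j + 1)), g t :=
        (Finset.abs_sum_le_sum_abs _ _).trans (Finset.sum_le_sum fun j _ =>
          abs_integral_massEndpoint_sub_le hg hg01 hp hφ (hω j j.2))
    _ = 2 * ω := by
        rw [← Finset.mul_sum, ← Finset.sum_range fun j => ∫ t in (p j)..(p (j + 1)), g t,
          intervalIntegral.sum_integral_adjacent_intervals fun j _ => hg _ _, hmass, mul_one]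

/-- The points of subdivision of `[-M, M]` into `n + 1` cells of equal length. -/
noncomputable def cellPoint (M : ℝ) (n j : ℕ) : ℝ := -M + j * (2 * M / (n + 1))

theorem cellPoint_zero (M : ℝ) (n : ℕ) : cellPoint M n 0 = -M := by simp [cellPoint]

theorem cellPoint_last (M : ℝ) (n : ℕ) : cellPoint M n (n + 1) = M := by
  rw [cellPoint, Nat.cast_add_one, mul_div_cancel₀ _ n.cast_add_one_ne_zero]
  ring

theorem cellPoint_succ (M : ℝ) (n j : ℕ) :
    cellPoint M n (j + 1) = cellPoint M n j + 2 * M / (n + 1) := by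
  rw [cellPoint, cellPoint]
  push_cast
  ring

variable {M : ℝ}

theorem strictMono_cellPoint (hM : 0 < M) (n : ℕ) : StrictMono (cellPoint M n) :=
  strictMono_nat_of_lt_succ fun j => by
    rw [cellPoint_succ]
    exact lt_add_of_pos_right _ (by positivity)

theorem Icc_cellPoint_subset (hM : 0 < M) {n j : ℕ} (hj : j < n + 1) :
    Set.Icc (cellPoint M n j) (cellPoint M n (j + 1)) ⊆ Set.Icc (-M) M := by
  have hmono := (strictMono_cellPoint hM n).monotone
  exact Set.Icc_subset_Icc ((cellPoint_zero M n).symm.trans_le (hmono j.zero_le))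
    ((hmono hj).trans_eq (cellPoint_last M n))

theorem eventually_abs_sub_cellPoint_le (hM : 0 < M) (hφ : Continuous φ) {ω : ℝ} (hω : 0 < ω) :
    ∀ᶠ n : ℕ in atTop, ∀ j < n + 1, ∀ t ∈ Set.Icc (cellPoint M n j) (cellPoint M n (j + 1)),
      |φ t - φ (cellPoint M n j)| ≤ ω := by
  obtain ⟨δ, hδ, hφδ⟩ := Metric.uniformContinuousOn_iff_le.1
    (isCompact_Icc.uniformContinuousOn_of_continuous (s := Set.Icc (-M) M) hφ.continuousOn) ω hω
  have hmesh : Tendsto (fun n : ℕ => 2 * M / ((n : ℝ) + 1)) atTop (𝓝 0) := by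
    simpa [div_eq_mul_inv] using tendsto_one_div_add_atTop_nhds_zero_nat.const_mul (2 * M)
  filter_upwards [hmesh.eventually_le_const hδ] with n hn j hj t ht
  have hsub := Icc_cellPoint_subset hM hj
  refine hφδ t (hsub ht) _ (hsub (Set.left_mem_Icc.2 (ht.1.trans ht.2))) ?_
  rw [Real.dist_eq, abs_of_nonneg (sub_nonneg.2 ht.1)]
  linarith [ht.2, cellPoint_succ M n j]

variable {f : ℝ → ℝ}

/-- A mixture of the density `f` and the uniform density on `[-M, M]` which makes a density with
values in `[0, 1]` take values in `(0, 1)`, so that the approximating intervals are neither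
degenerate nor adjacent. -/
noncomputable def mixedDensity (f : ℝ → ℝ) (M : ℝ) (n : ℕ) (t : ℝ) : ℝ :=
  (1 - 1 / (n + 1)) * f t + 1 / (n + 1) * (2 * M)⁻¹

theorem mixedDensity_mem_Ioo (hf01 : ∀ t, f t ∈ Set.Icc (0 : ℝ) 1) (hM : 1 ≤ M) (n : ℕ) (t : ℝ) :
    mixedDensity f M n t ∈ Set.Ioo (0 : ℝ) 1 := by
  have hε : 0 < 1 / ((n : ℝ) + 1) := by positivity
  have hε1 : 1 / ((n : ℝ) + 1) ≤ 1 := (div_le_one (by positivity)).2 (by simp)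
  have huniform : (2 * M)⁻¹ < 1 := inv_lt_one_of_one_lt₀ (by linarith)
  have huniform_pos : 0 < (2 * M)⁻¹ := by positivity
  rw [mixedDensity]
  constructor
  · exact add_pos_of_nonneg_of_pos (mul_nonneg (sub_nonneg.2 hε1) (hf01 t).1)
      (mul_pos hε huniform_pos)
  · have := mul_le_mul_of_nonneg_left (hf01 t).2 (sub_nonneg.2 hε1)
    have := mul_lt_mul_of_pos_left huniform hε
    linarith

theorem intervalIntegrable_mixedDensity (hf : Integrable f) (M : ℝ) (n : ℕ) (a b : ℝ) :
    IntervalIntegrable (mixedDensity f M n) volume a b :=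
  (hf.intervalIntegrable.const_mul _).add intervalIntegrable_const

theorem integral_mixedDensity_mul (hf : Integrable f) (hφ : Continuous φ) (M : ℝ) (n : ℕ) :
    ∫ t in (-M)..M, mixedDensity f M n t * φ t =
      (1 - 1 / (n + 1)) * (∫ t in (-M)..M, f t * φ t) +
        1 / (n + 1) * ((2 * M)⁻¹ * ∫ t in (-M)..M, φ t) := by
  rw [← intervalIntegral.integral_const_mul, ← intervalIntegral.integral_const_mul,
    ← intervalIntegral.integral_const_mul, ← intervalIntegral.integral_add
      ((hf.intervalIntegrable.mul_continuousOn hφ.continuousOn).const_mul _)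
      (((hφ.intervalIntegrable _ _).const_mul _).const_mul _)]
  congr 1
  ext t
  rw [mixedDensity]
  ring

theorem integral_mixedDensity (hf : Integrable f) (hM : 0 < M) (hmass : ∫ t in (-M)..M, f t = 1)
    (n : ℕ) : ∫ t in (-M)..M, mixedDensity f M n t = 1 := by
  have h := integral_mixedDensity_mul hf continuous_one M n
  simp only [Pi.one_apply, mul_one, hmass, intervalIntegral.integral_const, smul_eq_mul] at h
  rw [h, sub_neg_eq_add, ← two_mul, inv_mul_cancel₀ (by positivity), mul_one, sub_add_cancel]

theorem tendsto_integral_mixedDensity_mul (hf : Integrable f) (hφ : Continuous φ) (M : ℝ) :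
    Tendsto (fun n => ∫ t in (-M)..M, mixedDensity f M n t * φ t) atTop
      (𝓝 (∫ t in (-M)..M, f t * φ t)) := by
  have hε : Tendsto (fun n : ℕ => 1 / ((n : ℝ) + 1)) atTop (𝓝 0) :=
    tendsto_one_div_add_atTop_nhds_zero_nat
  simp only [integral_mixedDensity_mul hf hφ]
  simpa using ((hε.const_sub 1).mul_const (∫ t in (-M)..M, f t * φ t)).add
    (hε.mul_const ((2 * M)⁻¹ * ∫ t in (-M)..M, φ t))

theorem exists_isIntervalSystem_tendsto_integral (hf : Integrable f)
    (hf01 : ∀ t, f t ∈ Set.Icc (0 : ℝ) 1) (hM : 1 ≤ M) (hmass : ∫ t in (-M)..M, f t = 1) :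
    ∃ α β : ∀ n : ℕ, Fin (n + 1) → ℝ, (∀ n, IsIntervalSystem (α n) (β n)) ∧
      (∀ n i, Set.Icc (α n i) (β n i) ⊆ Set.Icc (-M) M) ∧
      ∀ φ : ℝ → ℝ, Continuous φ → Tendsto (fun n => ∫ t, φ t ∂(unionMeasure (α n) (β n))) atTop
        (𝓝 (∫ t in (-M)..M, f t * φ t)) := by
  have hM0 : 0 < M := one_pos.trans_le hM
  have hg := intervalIntegrable_mixedDensity hf M
  have hg01 := mixedDensity_mem_Ioo hf01 hM
  have hp := strictMono_cellPoint hM0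
  have hgmass : ∀ n : ℕ,
      ∫ t in (cellPoint M n 0)..(cellPoint M n (n + 1)), mixedDensity f M n t = 1 := fun n => by
    rw [cellPoint_zero, cellPoint_last, integral_mixedDensity hf hM0 hmass]
  refine ⟨fun n j => cellPoint M n j,
    fun n j => massEndpoint (mixedDensity f M n) (cellPoint M n) j,
    fun n => isIntervalSystem_massEndpoint (hg n) (hg01 n) (hp n) (hgmass n), fun n j => ?_,
    fun φ hφ => ?_⟩
  · exact (Set.Icc_subset_Icc_right (massEndpoint_mem_Ioo (hg n) (hg01 n) (hp n) j).2.le).trans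
      (Icc_cellPoint_subset hM0 j.2)
  · refine (tendsto_iff_of_dist ?_).2 (tendsto_integral_mixedDensity_mul hf hφ M)
    refine Metric.tendsto_nhds.2 fun ε hε => ?_
    filter_upwards [eventually_abs_sub_cellPoint_le hM0 hφ (ω := ε / 3) (by positivity)] with n hn
    have hle := abs_integral_unionMeasure_sub_le (hg n) (hg01 n) (hp n) (hgmass n) hφ hn
    rw [cellPoint_zero, cellPoint_last] at hle
    rw [Real.dist_0_eq_abs, abs_of_nonneg dist_nonneg, Real.dist_eq]
    linarith

end CellApproximation

section Density

theorem integral_withDensity_mul_eq {f φ : ℝ → ℝ} (hf : Measurable f) (hf0 : ∀ x, 0 ≤ f x) {M : ℝ}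
    (hM : 0 ≤ M)
    (h : ∀ᵐ t ∂(volume.withDensity fun x => ENNReal.ofReal (f x)), |t| ≤ M) :
    ∫ t, φ t ∂(volume.withDensity fun x => ENNReal.ofReal (f x)) =
      ∫ t in (-M)..M, f t * φ t := by
  rw [integral_withDensity_eq_integral_toReal_smul hf.ennreal_ofReal
      (.of_forall fun _ => ENNReal.ofReal_lt_top),
    intervalIntegral.integral_of_le (by linarith), ← integral_Icc_eq_integral_Ioc]
  rw [ae_withDensity_iff hf.ennreal_ofReal] at h
  simp only [ENNReal.toReal_ofReal (hf0 _), smul_eq_mul]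
  refine (setIntegral_eq_integral_of_ae_compl_eq_zero (h.mono fun t ht hmem => ?_)).symm
  by_contra hne
  have hft : f t ≠ 0 := left_ne_zero_of_mul hne
  exact hmem (abs_le.1 (ht (ENNReal.ofReal_pos.2 ((hf0 t).lt_of_ne' hft)).ne'))

theorem integrable_of_isFiniteMeasure_withDensity {f : ℝ → ℝ} (hf : Measurable f)
    (hf0 : ∀ x, 0 ≤ f x)
    [IsFiniteMeasure (volume.withDensity fun x => ENNReal.ofReal (f x))] : Integrable f := by
  refine (lintegral_ofReal_ne_top_iff_integrable hf.aestronglyMeasurable (.of_forall hf0)).1 ?_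
  rw [← setLIntegral_univ, ← withDensity_apply _ MeasurableSet.univ]
  exact measure_ne_top _ _

theorem exists_isIntervalSystem_tendsto_integral_of_mem_boundedDensity {μ : ProbabilityMeasure ℝ}
    (hμ : μ ∈ BoundedDensity 1) :
    ∃ (M : ℝ) (α β : ∀ n : ℕ, Fin (n + 1) → ℝ), (∀ n, IsIntervalSystem (α n) (β n)) ∧
      (∀ n i, Set.Icc (α n i) (β n i) ⊆ Set.Icc (-M) M) ∧
      ∀ φ : ℝ → ℝ, Continuous φ → Tendsto (fun n => ∫ t, φ t ∂(unionMeasure (α n) (β n))) atTop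
        (𝓝 (∫ t, φ t ∂(μ : Measure ℝ))) := by
  obtain ⟨hcompact, f, hf, hf01, hμf⟩ := hμ
  obtain ⟨ρ, -, hρ⟩ := exists_ae_abs_le_of_isCompact_support hcompact
  have hM : ∀ᵐ t ∂(μ : Measure ℝ), |t| ≤ max ρ 1 := hρ.mono fun t ht => ht.trans (le_max_left _ _)
  have hfinite : IsFiniteMeasure (μ : Measure ℝ) := inferInstance
  have hmass : ∫ _, (1 : ℝ) ∂(μ : Measure ℝ) = 1 := by simp
  rw [hμf] at hM hfinite hmass ⊢
  have hf0 : ∀ x, 0 ≤ f x := fun x => (hf01 x).1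
  have hM0 : 0 ≤ max ρ 1 := zero_le_one.trans (le_max_right _ _)
  simp only [integral_withDensity_mul_eq hf hf0 hM0 hM, mul_one] at hmass ⊢
  exact ⟨max ρ 1, exists_isIntervalSystem_tendsto_integral
    (integrable_of_isFiniteMeasure_withDensity hf hf0) hf01 (le_max_right _ _) hmass⟩

theorem exists_seq_intervalFamily_tendsto {q : ℝ} (hq0 : q ≠ 0) (hq1 : |q| < 1)
    {ν : ProbabilityMeasure ℝ} (hν : ν ∈ markovKreinImage q (BoundedDensity 1)) :
    ∃ u : ℕ → ProbabilityMeasure ℝ, (∀ n, u n ∈ intervalFamily q) ∧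
      Tendsto u atTop (𝓝 ν) ∧
      ∀ k : ℕ, Tendsto (fun n => ∫ t : ℝ, t ^ k ∂(u n : Measure ℝ)) atTop
        (𝓝 (∫ t : ℝ, t ^ k ∂(ν : Measure ℝ))) := by
  obtain ⟨μ, hμ, hμν⟩ := hν
  obtain ⟨M, α, β, hsystem, hsub, hlim⟩ :=
    exists_isIntervalSystem_tendsto_integral_of_mem_boundedDensity hμ
  obtain ⟨ρ, -, hνρ⟩ := exists_ae_abs_le_of_isCompact_support hμν.2.1
  have hmoments := MarkovKreinRecursion.tendsto
    (fun n => (hsystem n).markovKreinRecursion hq0 hq1) (hμν.markovKreinRecursion hq0)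
    fun k => hlim _ (continuous_pow k)
  refine ⟨fun n => ⟨intervalMeasure q (α n) (β n),
    (hsystem n).isProbabilityMeasure_intervalMeasure hq0 hq1⟩,
    fun n => ⟨n + 1, α n, β n, hsystem n, rfl⟩, ?_, hmoments⟩
  refine tendsto_of_tendsto_integral_pow (ρ := max M ρ) (fun n => ?_)
    (hνρ.mono fun t ht => ht.trans (le_max_right _ _)) hmoments
  refine (ae_mem_intervalMeasure q (α n) (β n)).mono fun t ht => ?_
  exact (abs_le.2 (Set.iUnion_subset (hsub n) ht)).trans (le_max_left _ _)

end Density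

theorem mainTheorem11 (q : ℝ) (hq : q ∈ Set.Ioo (-1 : ℝ) 0 ∪ Set.Ioo (0 : ℝ) 1) :
    (∀ (r : ℕ) (α β : Fin r → ℝ), IsIntervalSystem α β →
      IsProbabilityMeasure (intervalMeasure q α β)) ∧
    intervalFamily q ⊆ markovKreinImage q (BoundedDensity 1) ∧
    markovKreinImage q (BoundedDensity 1) ⊆ closure (intervalFamily q) ∧
    ∀ ν ∈ markovKreinImage q (BoundedDensity 1),
      ∃ u : ℕ → ProbabilityMeasure ℝ, (∀ n, u n ∈ intervalFamily q) ∧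
        Tendsto u atTop (𝓝 ν) ∧
        ∀ k : ℕ, Tendsto (fun n => ∫ t : ℝ, t ^ k ∂(u n : Measure ℝ)) atTop
          (𝓝 (∫ t : ℝ, t ^ k ∂(ν : Measure ℝ))) := by
  have hq0 : q ≠ 0 := by
    rintro rfl
    simp at hq
  have hq1 : |q| < 1 := by
    rcases hq with hq | hq <;> exact abs_lt.2 ⟨by linarith [hq.1], by linarith [hq.2]⟩
  refine ⟨fun r α β h => h.isProbabilityMeasure_intervalMeasure hq0 hq1,
    intervalFamily_subset_markovKreinImage hq0 hq1, fun ν hν => ?_,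
    fun ν hν => exists_seq_intervalFamily_tendsto hq0 hq1 hν⟩
  obtain ⟨u, hu, hlim, -⟩ := exists_seq_intervalFamily_tendsto hq0 hq1 hν
  exact mem_closure_of_tendsto hlim (.of_forall hu)
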